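/- Let $n\ge 3$, $k,p\ge 0$ with $n=1+k+p$, $\ell>0$, $m,q,a_1,\dots,a_k\in\mathbb R$, $\Xi=\sqrt{1+\sum_i a_i^2/\ell^2}$ and $$f(r)=\frac{r^2}{\ell^2}-\frac{m}{r^{n-2}}+\frac{q^2}{r^{2n-4}} .$$ Consider the $(n+1)$-dimensional charged rotating black brane $$ds^2=-f\Big(\Xi\,dt-\sum_i a_i d\phi_i\Big)^2+\frac{r^2}{\ell^4}\sum_i(a_i dt-\Xi\ell^2 d\phi_i)^2+\frac{dr^2}{f}-\frac{r^2}{\ell^2}\sum_{i<j}(a_i d\phi_j-a_j d\phi_i)^2+r^2 d\Omega^2,$$ where $d\Omega^2$ is the flat metric on a $p=n-1-k$ dimensional coordinate domain of finite volume $V$ and each $\phi_i$ has period $2\pi$, with gauge potential $$A_\mu dx^\mu=-\sqrt{\tfrac{n-1}{2n-4}}\,\frac{q}{r^{n-2}}\Big(\Xi\,dt-\sum_i a_i d\phi_i\Big)+c ,$$ $c$ a constant (pure gauge) one-form. Let $r_+>0$ be a non-extreme outer horizon: $f(r_+)=0$, $f>0$ on $(r_+,\infty)$, $f'(r_+)>0$.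 Put $\beta=4\pi\Xi/f'(r_+)$, and pass to the Euclidean section $t=i\tau$, $0\le\tau\le\beta$, with $r_+\le r\le\mathcal R$. Let $\gamma$ be the metric induced on $r=\mathcal R$, $n^\mu$ its outward unit normal, $\Theta=-\gamma^{\mu\nu}\nabla_\mu n_\nu$, $\Lambda=-n(n-1)/2\ell^2$, $F=dA$, and let $\Upsilon(x)=1$ for $x\ge0$ and $0$ otherwise. Define $$I_G=-\frac1{16\pi}\int\sqrt g\,(R-2\Lambda-F_{\mu\nu}F^{\mu\nu})+\frac1{8\pi}\int_{r=\mathcal R}\sqrt\gamma\,\Theta ,$$ $$I_{ct}=\frac1{8\pi}\int_{r=\mathcal R}\sqrt\gamma\Big\{\frac{n-1}{\ell}-\frac{\ell\Upsilon(n-3)}{2(n-2)}R-\frac{\ell^3\Upsilon(n-5)}{2(n-4)(n-2)^2}\Big(R_{ab}R^{ab}-\frac{n}{4(n-1)}R^2\Big)+\mathcal H\Big\},$$ with curvatures of $\gamma$ in $I_{ct}$, where $\mathcal H$ (the higher-order counterterms) is an arbitrary local scalar built from the Riemann tensor of $\gamma$, its covariant derivatives, products, contractions and linear combinations, each term containing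 curvature. Then: 1. For every $\mathcal R>r_+$ all the integrals occurring in $I_G$, $I_{ct}$ and in item 3 converge. 2. (Grand-canonical ensemble) As $\mathcal R\to\infty$, $I_G+I_{ct}$ converges to $$I=-\frac{\beta V(2\pi)^k}{16\pi}\,\frac{r_+^{2n-2}+q^2\ell^2}{r_+^{n-2}\ell^2}.$$ 3. (Canonical ensemble) If the gauge is regular at the horizon, i.e. $A_\mu\chi^\mu=0$ at $r=r_+$ for $\chi=\partial_t+\sum_i\frac{a_i}{\Xi\ell^2}\partial_{\phi_i}$, then as $\mathcal R\to\infty$, $I_G+I_{ct}-\frac1{4\pi}\int_{r=\mathcal R}\sqrt\gamma\,n_aF^{ab}A_b$ converges to $$\tilde I=-\frac{\beta V(2\pi)^k}{16\pi}\,\frac{r_+^{2n-2}-(2n-3)q^2\ell^2}{r_+^{n-2}\ell^2}.$$ 4. There is a radial coordinate $x\to0^+$ near $r=\infty$ with $dr^2/f=\ell^2dx^2/x^2$ and $xr\to1$. For every such coordinate the leading boundary metric $\gamma^0_{ij}=\lim_{x\to0}x^2\gamma_{ij}$ is the flat metric $-dt^2/\ell^2+\sum_i d\phi_i^2+d\Omega^2$,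 so its Riemann, Ricci and scalar curvatures vanish, and the leading field $F^0_{ij}$ (the limit of the field strength induced on the surfaces $x=\mathrm{const}$) is $0$. 5. Hence for every $\varepsilon>0$ the logarithmic divergences vanish, all tensors below being those of $\gamma^0$, $F^0$: for $n=4$ $$-\frac{\ell^3\ln\varepsilon}{64\pi}\int\sqrt{-\gamma^0}\big[R_{ij}R^{ij}-\tfrac13R^2\big]=0,\qquad \frac{\ell\ln\varepsilon}{64\pi}\int\sqrt{-\gamma^0}\,F_{ij}F^{ij}=0;$$ for $n=6$ $$\frac{\ell^3\ln\varepsilon}{8^4\pi}\int\sqrt{-\gamma^0}\big\{\tfrac3{50}R^3+R^{ij}R^{kl}R_{ijkl}-\tfrac12RR^{ij}R_{ij}+\tfrac15R^{ij}D_iD_jR-\tfrac12R^{ij}\Box R_{ij}+\tfrac1{20}R\Box R\big\}=0,$$ $$\frac{\ell^3\ln\varepsilon}{8\pi}\int\sqrt{-\gamma^0}\big\{\tfrac1{16}RF^2-\tfrac18R^{ij}F_i{}^lF_{jl}+\tfrac1{64}F^{ij}[D_jD^kF_{ki}-D_iD^kF_{kj}]\big\}=0;$$ and for every $n$, $\ln\varepsilon\int\sqrt{-\gamma^0}\,L=0$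 for every local scalar $L$ built in the same way as $\mathcal H$ from curvature and the field, each term containing at least one such factor. 6. For $n>4$ the electromagnetic counterterm $\frac{\ell}{256\pi}\int_{r=\mathcal R}\sqrt\gamma\,\frac{n-8}{n-4}F^2$ is zero for every $\mathcal R>r_+$ when $F$ is the field induced on the boundary, and tends to $0$ as $\mathcal R\to\infty$ when $F$ is the full bulk field strength. -/

import Mathlib

open Filter Topology MeasureTheory

noncomputable section

namespace BlackBrane

/-! ### Coordinate differential geometry

Fields live on a coordinate space `ι → ℝ` and take values in `𝕜`, which is `ℝ` for the Lorentzian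
metrics and `ℂ` for the Euclidean section (where the metric of a rotating solution is complex). -/

section Geometry

variable {ι : Type*} [Fintype ι] [DecidableEq ι] {𝕜 : Type*} [RCLike 𝕜]

/-- A metric `g_{ab}(x)` in coordinates. -/
abbrev MetricField (ι : Type*) (𝕜 : Type*) := (ι → ℝ) → Matrix ι ι 𝕜

/-- A covariant tensor field `T_{a₁ … a_s}(x)` in coordinates. -/
abbrev TensorField (ι : Type*) (𝕜 : Type*) (s : ℕ) := (ι → ℝ) → (Fin s → ι) → 𝕜

/-- The partial derivative `∂ᵢ u`. -/
def pd (i : ι) (u : (ι → ℝ) → 𝕜) (x : ι → ℝ) : 𝕜 :=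
  deriv (fun s : ℝ => u (Function.update x i s)) (x i)

/-- The Christoffel symbols `Γ^a_{bc}`. -/
def christoffel (g : MetricField ι 𝕜) (x : ι → ℝ) (a b c : ι) : 𝕜 :=
  1 / 2 * ∑ d, (g x)⁻¹ a d *
    (pd b (fun y => g y d c) x + pd c (fun y => g y d b) x - pd d (fun y => g y b c) x)

/-- The curvature `R^a_{bcd} = ∂_c Γ^a_{db} - ∂_d Γ^a_{cb} + Γ^a_{ce} Γ^e_{db} - Γ^a_{de} Γ^e_{cb}`;
spheres have positive scalar curvature. -/
def riemann (g : MetricField ι 𝕜) (x : ι → ℝ) (a b c d : ι) : 𝕜 :=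
  pd c (fun y => christoffel g y a d b) x - pd d (fun y => christoffel g y a c b) x
    + ∑ e, (christoffel g x a c e * christoffel g x e d b
            - christoffel g x a d e * christoffel g x e c b)

/-- The Riemann tensor `R_{abcd}` with all indices down. -/
def riemannDown (g : MetricField ι 𝕜) : TensorField ι 𝕜 4 :=
  fun x i => ∑ e, g x (i 0) e * riemann g x e (i 1) (i 2) (i 3)

/-- The Ricci tensor `R_{bd} = R^a_{bad}`. -/
def ricci (g : MetricField ι 𝕜) : TensorField ι 𝕜 2 :=
  fun x i => ∑ a, riemann g x a (i 0) a (i 1)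

/-- The scalar curvature. -/
def scalarCurv (g : MetricField ι 𝕜) (x : ι → ℝ) : 𝕜 :=
  ∑ b, ∑ d, (g x)⁻¹ b d * ricci g x ![b, d]

/-- The covariant derivative `(∇T)_{c a₁ … a_s} = ∇_c T_{a₁ … a_s}`; the new index comes first. -/
def covD (g : MetricField ι 𝕜) {s : ℕ} (T : TensorField ι 𝕜 s) : TensorField ι 𝕜 (s + 1) :=
  fun x i => pd (i 0) (fun y => T y (Fin.tail i)) x
    - ∑ m, ∑ e, christoffel g x e (i 0) (Fin.tail i m) *
        T x (Function.update (Fin.tail i) m e)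

/-- A scalar field as a tensor field of rank `0`. -/
def ofScalar (u : (ι → ℝ) → 𝕜) : TensorField ι 𝕜 0 := fun x _ => u x

/-- Contraction of the first two indices with the inverse metric. -/
def contract (g : MetricField ι 𝕜) {s : ℕ} (T : TensorField ι 𝕜 (s + 2)) : TensorField ι 𝕜 s :=
  fun x i => ∑ a, ∑ b, (g x)⁻¹ a b * T x (Fin.cons a (Fin.cons b i))

/-- The wave operator `□T = g^{cd} ∇_c ∇_d T`. -/
def box (g : MetricField ι 𝕜) {s : ℕ} (T : TensorField ι 𝕜 s) : TensorField ι 𝕜 s :=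
  contract g (covD g (covD g T))

/-- Both indices of a rank-two tensor raised, `T^{ab}`. -/
def raise2 (g : MetricField ι 𝕜) (T : TensorField ι 𝕜 2) (x : ι → ℝ) (a b : ι) : 𝕜 :=
  ∑ c, ∑ d, (g x)⁻¹ a c * (g x)⁻¹ b d * T x ![c, d]

/-- The scalar `T_{ab} T^{ab}`. -/
def normSq2 (g : MetricField ι 𝕜) (T : TensorField ι 𝕜 2) (x : ι → ℝ) : 𝕜 :=
  ∑ a, ∑ b, T x ![a, b] * raise2 g T x a b

/-- The volume density `√|det g|`, which is `√(-g)` for a Lorentzian metric and `√g` on the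
Euclidean section, where `det g > 0`. -/
def volDensity (g : MetricField ι 𝕜) (x : ι → ℝ) : ℝ := √‖(g x).det‖

/-- The field strength `F_{ab} = ∂_a A_b - ∂_b A_a`. -/
def fieldStrength (A : (ι → ℝ) → ι → 𝕜) : TensorField ι 𝕜 2 :=
  fun x i => pd (i 0) (fun y => A y (i 1)) x - pd (i 1) (fun y => A y (i 0)) x

/-- The unit normal covector `n_μ` of the hypersurfaces on which the coordinate `s` is constant,
pointing to increasing `s`. -/
def unitConormal (g : MetricField ι 𝕜) (s : ι) (x : ι → ℝ) (μ : ι) : 𝕜 :=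
  if μ = s then (((√‖(g x)⁻¹ s s‖)⁻¹ : ℝ) : 𝕜) else 0

/-- The unit normal vector `n^μ`. -/
def unitNormal (g : MetricField ι 𝕜) (s : ι) (x : ι → ℝ) (μ : ι) : 𝕜 :=
  ∑ ν, (g x)⁻¹ μ ν * unitConormal g s x ν

/-- The extrinsic curvature `Θ_{μν} = -γ_μ^α ∇_α n_ν` of the hypersurfaces `s = const`, where
`γ_μ^α = δ_μ^α - n_μ n^α`. -/
def extrinsicCurv (g : MetricField ι 𝕜) (s : ι) (x : ι → ℝ) (μ ν : ι) : 𝕜 :=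
  -∑ α, ((if α = μ then 1 else 0) - unitConormal g s x μ * unitNormal g s x α) *
    (pd α (fun y => unitConormal g s y ν) x
      - ∑ e, christoffel g x e α ν * unitConormal g s x e)

/-- The trace `Θ` of the extrinsic curvature. -/
def extrinsicTrace (g : MetricField ι 𝕜) (s : ι) (x : ι → ℝ) : 𝕜 :=
  ∑ μ, ∑ ν, (g x)⁻¹ μ ν * extrinsicCurv g s x μ ν

/-- Universal local tensor expressions built from the Riemann tensor and a two-form `F` with real
coefficients: covariant derivatives, products, permutations of indices, contractions with the
inverse metric, and linear combinations. Every term has at least one factor of curvature or `F`.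
The expressions of rank `0` are the local scalar invariants. -/
inductive LocalExpr : ℕ → Type
  | riem : LocalExpr 4
  | field : LocalExpr 2
  | covD {s : ℕ} : LocalExpr s → LocalExpr (s + 1)
  | mul {s t : ℕ} : LocalExpr s → LocalExpr t → LocalExpr (s + t)
  | perm {s : ℕ} : Equiv.Perm (Fin s) → LocalExpr s → LocalExpr s
  | contract {s : ℕ} : LocalExpr (s + 2) → LocalExpr s
  | add {s : ℕ} : LocalExpr s → LocalExpr s → LocalExpr s
  | smul {s : ℕ} : ℝ → LocalExpr s → LocalExpr s

/-- The tensor field that a local expression denotes, for a metric `g` and a two-form `F`. -/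
def LocalExpr.eval (g : MetricField ι 𝕜) (F : TensorField ι 𝕜 2) :
    {s : ℕ} → LocalExpr s → TensorField ι 𝕜 s
  | _, .riem => riemannDown g
  | _, .field => F
  | _, .covD e => BlackBrane.covD g (e.eval g F)
  | _, .mul e₁ e₂ => fun x i =>
      e₁.eval g F x (fun j => i (Fin.castAdd _ j)) * e₂.eval g F x (fun j => i (Fin.natAdd _ j))
  | _, .perm σ e => fun x i => e.eval g F x (fun j => i (σ j))
  | _, .contract e => BlackBrane.contract g (e.eval g F)
  | _, .add e₁ e₂ => fun x i => e₁.eval g F x i + e₂.eval g F x i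
  | _, .smul c e => fun x i => (c : 𝕜) * e.eval g F x i

end Geometry

/-! ### Coordinates of the brane -/

/-- Boundary coordinates: time `t`, the `k` angles `φ_i`, and `p` flat coordinates. -/
abbrev BIdx (k p : ℕ) := Unit ⊕ (Fin k ⊕ Fin p)

/-- Bulk coordinates: the radial coordinate `r` and the boundary coordinates. -/
abbrev Idx (k p : ℕ) := Unit ⊕ BIdx k p

namespace Idx

variable {k p : ℕ}

/-- The radial index. -/
abbrev r : Idx k p := Sum.inl ()
/-- The time index. -/
abbrev t : Idx k p := Sum.inr (Sum.inl ())
/-- The index of the angle `φ_i`. -/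
abbrev phi (i : Fin k) : Idx k p := Sum.inr (Sum.inr (Sum.inl i))
/-- The index of the `j`-th flat coordinate. -/
abbrev flat (j : Fin p) : Idx k p := Sum.inr (Sum.inr (Sum.inr j))

end Idx

section Hypersurface

variable {k p : ℕ} {𝕜 : Type*} [RCLike 𝕜]

/-- The point with radial coordinate `R` and boundary coordinates `y`. -/
def atRadius (R : ℝ) (y : BIdx k p → ℝ) : Idx k p → ℝ := Sum.elim (fun _ => R) y

/-- The metric `γ` induced on the hypersurface `r = R`. -/
def inducedMetric (g : MetricField (Idx k p) 𝕜) (R : ℝ) : MetricField (BIdx k p) 𝕜 :=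
  fun y => (g (atRadius R y)).submatrix Sum.inr Sum.inr

/-- The pull-back of a covariant two-tensor to the hypersurface `r = R`. -/
def inducedField (F : TensorField (Idx k p) 𝕜 2) (R : ℝ) : TensorField (BIdx k p) 𝕜 2 :=
  fun y i => F (atRadius R y) (fun j => Sum.inr (i j))

/-- Wick rotation `t = iτ` of a covector: `A_τ = i A_t`, other components unchanged. -/
def wickFactor (μ : Idx k p) : ℂ := if μ = Idx.t then Complex.I else 1

/-- The metric on the Euclidean section `t = iτ`, `τ` real. -/
def wickMetric (g : MetricField (Idx k p) ℝ) : MetricField (Idx k p) ℂ :=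
  fun x => Matrix.of fun μ ν => wickFactor μ * wickFactor ν * (g x μ ν : ℂ)

/-- The gauge potential on the Euclidean section `t = iτ`, `τ` real. -/
def wickPotential (A : (Idx k p → ℝ) → Idx k p → ℝ) : (Idx k p → ℝ) → Idx k p → ℂ :=
  fun x μ => wickFactor μ * (A x μ : ℂ)

end Hypersurface

/-! ### The charged rotating black brane -/

/-- The parameters of the brane in `n + 1` dimensions: the AdS radius `ℓ`, the mass and charge
parameters `m`, `q`, and the rotation parameters `a_i`. -/
structure Brane (n k p : ℕ) where
  ℓ : ℝ
  m : ℝ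
  q : ℝ
  a : Fin k → ℝ

namespace Brane

variable {n k p : ℕ} (B : Brane n k p)

/-- `Ξ = √(1 + ∑ a_i² / ℓ²)`. -/
def Xi : ℝ := √(1 + ∑ i, B.a i ^ 2 / B.ℓ ^ 2)

/-- `f(r) = r²/ℓ² - m/r^{n-2} + q²/r^{2n-4}`. -/
def f (r : ℝ) : ℝ := r ^ 2 / B.ℓ ^ 2 - B.m / r ^ (n - 2) + B.q ^ 2 / r ^ (2 * n - 4)

/-- The coordinate one-form `dx^μ`. -/
def dx (μ : Idx k p) : Idx k p → ℝ := Pi.single μ 1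

/-- The symmetric tensor `ω ⊗ ω` of a one-form. -/
def sq (ω : Idx k p → ℝ) : Matrix (Idx k p) (Idx k p) ℝ := Matrix.vecMulVec ω ω

/-- The one-form `Ξ dt - ∑ a_i dφ_i`. -/
def omega : Idx k p → ℝ := B.Xi • dx Idx.t - ∑ i, B.a i • dx (Idx.phi i)

/-- The metric
`-f (Ξ dt - ∑ a_i dφ_i)² + r²/ℓ⁴ ∑ (a_i dt - Ξ ℓ² dφ_i)² + dr²/f
  - r²/ℓ² ∑_{i<j} (a_i dφ_j - a_j dφ_i)² + r² dΩ²`, with `dΩ²` the flat metric in the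
remaining `p` coordinates. -/
def metric : MetricField (Idx k p) ℝ := fun x =>
  let r := x Idx.r
  (-B.f r) • sq B.omega
    + (r ^ 2 / B.ℓ ^ 4) •
        ∑ i, sq (B.a i • dx Idx.t - (B.Xi * B.ℓ ^ 2) • dx (Idx.phi i))
    + (1 / B.f r) • sq (dx Idx.r)
    - (r ^ 2 / B.ℓ ^ 2) •
        ∑ i, ∑ j ∈ Finset.Ioi i, sq (B.a i • dx (Idx.phi j) - B.a j • dx (Idx.phi i))
    + r ^ 2 • ∑ j, sq (dx (Idx.flat j))

/-- The gauge potential `A = -√((n-1)/(2n-4)) q r^{-(n-2)} (Ξ dt - ∑ a_i dφ_i) + c`, where the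
constant one-form `c` is pure gauge. -/
def potential (c : Idx k p → ℝ) (x : Idx k p → ℝ) (μ : Idx k p) : ℝ :=
  -√((n - 1) / (2 * n - 4)) * (B.q / x Idx.r ^ (n - 2)) * B.omega μ + c μ

/-- The null generator `χ = ∂_t + ∑ Ω_i ∂_{φ_i}` of the horizon, `Ω_i = a_i / (Ξ ℓ²)`. -/
def chi : Idx k p → ℝ := dx Idx.t + ∑ i, (B.a i / (B.Xi * B.ℓ ^ 2)) • dx (Idx.phi i)

/-- `rp` is the radius of a non-extreme outer horizon. -/
structure IsOuterHorizon (rp : ℝ) : Prop where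
  pos : 0 < rp
  root : B.f rp = 0
  outside : ∀ r, rp < r → 0 < B.f r
  nonextreme : 0 < deriv B.f rp

/-- The gauge is regular at the horizon: `A_μ χ^μ = 0` at `r = rp`, where `χ` vanishes on the
Euclidean section. -/
def IsRegularGauge (rp : ℝ) (c : Idx k p → ℝ) : Prop :=
  ∀ x : Idx k p → ℝ, x Idx.r = rp → ∑ μ, B.potential c x μ * B.chi μ = 0

/-- The inverse Hawking temperature `β = 4πΞ / f'(rp)`. -/
def beta (rp : ℝ) : ℝ := 4 * Real.pi * B.Xi / deriv B.f rp

/-- The region covered by the boundary coordinates: one period `β` of Euclidean time, one period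
`2π` of each angle, and the coordinate domain `Y` of the flat submanifold. -/
def bdryRegion (Y : Set (Fin p → ℝ)) (rp : ℝ) : Set (BIdx k p → ℝ) :=
  {y | y (Sum.inl ()) ∈ Set.Icc 0 (B.beta rp) ∧
    (∀ i, y (Sum.inr (Sum.inl i)) ∈ Set.Icc 0 (2 * Real.pi)) ∧
    (fun j => y (Sum.inr (Sum.inr j))) ∈ Y}

/-- The bulk region between the horizon and the cutoff `r = R`. -/
def bulkRegion (Y : Set (Fin p → ℝ)) (rp R : ℝ) : Set (Idx k p → ℝ) :=
  {x | x Idx.r ∈ Set.Icc rp R ∧ (fun b => x (Sum.inr b)) ∈ B.bdryRegion Y rp}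

/-- The Euclidean metric. -/
def euclMetric : MetricField (Idx k p) ℂ := wickMetric B.metric

/-- The Euclidean gauge potential. -/
def euclPotential (c : Idx k p → ℝ) : (Idx k p → ℝ) → Idx k p → ℂ := wickPotential (B.potential c)

/-- The metric induced by the Euclidean metric on the cutoff surface `r = R`. -/
def cutoffMetric (R : ℝ) : MetricField (BIdx k p) ℂ := inducedMetric B.euclMetric R

/-- The cosmological constant `Λ = -n(n-1)/(2ℓ²)`. -/
def Lambda : ℝ := -(n * (n - 1)) / (2 * B.ℓ ^ 2)

/-- `√g (R - 2Λ - F_{μν}F^{μν})`. -/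
def bulkDensity (c : Idx k p → ℝ) (x : Idx k p → ℝ) : ℂ :=
  volDensity B.euclMetric x * (scalarCurv B.euclMetric x - 2 * (B.Lambda : ℂ)
    - normSq2 B.euclMetric (fieldStrength (B.euclPotential c)) x)

/-- `√γ Θ`. -/
def ghDensity (R : ℝ) (y : BIdx k p → ℝ) : ℂ :=
  volDensity (B.cutoffMetric R) y * extrinsicTrace B.euclMetric Idx.r (atRadius R y)

/-- The step function `Υ(x)`, equal to one for `x ≥ 0` and to zero otherwise. -/
def step (x : ℝ) : ℝ := if 0 ≤ x then 1 else 0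

/-- The density of the gravitational counterterm,
`√γ {(n-1)/ℓ - ℓΥ(n-3)/(2(n-2)) R - ℓ³Υ(n-5)/(2(n-4)(n-2)²) (R_{ab}R^{ab} - n/(4(n-1)) R²) + …}`,
where the further terms `…` are any local curvature invariant `H` of `γ`. -/
def ctDensity (H : LocalExpr 0) (R : ℝ) (y : BIdx k p → ℝ) : ℂ :=
  let γ := B.cutoffMetric R
  volDensity γ y * ((((n - 1) / B.ℓ : ℝ) : ℂ)
    - ((B.ℓ * step (n - 3) / (2 * (n - 2)) : ℝ) : ℂ) * scalarCurv γ y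
    - ((B.ℓ ^ 3 * step (n - 5) / (2 * (n - 4) * (n - 2) ^ 2) : ℝ) : ℂ) *
        (normSq2 γ (ricci γ) y - ((n / (4 * (n - 1)) : ℝ) : ℂ) * scalarCurv γ y ^ 2)
    + H.eval γ 0 y ![])

/-- `√γ n_a F^{ab} A_b`. -/
def chargeDensity (c : Idx k p → ℝ) (R : ℝ) (y : BIdx k p → ℝ) : ℂ :=
  volDensity (B.cutoffMetric R) y *
    ∑ a, ∑ b, unitConormal B.euclMetric Idx.r (atRadius R y) a *
      raise2 B.euclMetric (fieldStrength (B.euclPotential c)) (atRadius R y) a b *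
      B.euclPotential c (atRadius R y) b

/-- The Einstein–Maxwell action with Gibbons–Hawking term,
`I_G = -1/(16π) ∫ √g (R - 2Λ - F²) + 1/(8π) ∫ √γ Θ`, with the boundary at `r = R`. -/
def actionG (Y : Set (Fin p → ℝ)) (rp : ℝ) (c : Idx k p → ℝ) (R : ℝ) : ℂ :=
  -(1 / (16 * Real.pi)) * (∫ x in B.bulkRegion Y rp R, B.bulkDensity c x)
    + 1 / (8 * Real.pi) * ∫ y in B.bdryRegion Y rp, B.ghDensity R y

/-- The counterterm action `I_ct`, with the boundary at `r = R`. -/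
def actionCt (Y : Set (Fin p → ℝ)) (rp : ℝ) (H : LocalExpr 0) (R : ℝ) : ℂ :=
  1 / (8 * Real.pi) * ∫ y in B.bdryRegion Y rp, B.ctDensity H R y

/-- The grand-canonical action `I = I_G + I_ct`, with the boundary at `r = R`. -/
def actionGC (Y : Set (Fin p → ℝ)) (rp : ℝ) (c : Idx k p → ℝ) (H : LocalExpr 0) (R : ℝ) : ℂ :=
  B.actionG Y rp c R + B.actionCt Y rp H R

/-- The canonical action `Ĩ = I - 1/(4π) ∫ √γ n_a F^{ab} A_b`, with the boundary at `r = R`. -/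
def actionC (Y : Set (Fin p → ℝ)) (rp : ℝ) (c : Idx k p → ℝ) (H : LocalExpr 0) (R : ℝ) : ℂ :=
  B.actionGC Y rp c H R - 1 / (4 * Real.pi) * ∫ y in B.bdryRegion Y rp, B.chargeDensity c R y

/-! ### Leading boundary data and the logarithmic divergences -/

/-- `r = ρ(x)`, `0 < x < x₀`, is an asymptotic radial coordinate: `dr²/f = ℓ² dx²/x²`, so that
`ds² = (ℓ²/x²) dx² + x⁻² γ̃_{ij} dx^i dx^j`, normalized by `x r → 1` as `x → 0`. -/
structure IsAsymptoticCoordinate (rp x₀ : ℝ) (ρ : ℝ → ℝ) : Prop where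
  pos : 0 < x₀
  outside : ∀ x ∈ Set.Ioo 0 x₀, rp < ρ x
  differentiable : ∀ x ∈ Set.Ioo 0 x₀, DifferentiableAt ℝ ρ x
  radial : ∀ x ∈ Set.Ioo 0 x₀, deriv ρ x ^ 2 / B.f (ρ x) = B.ℓ ^ 2 / x ^ 2
  normalized : Tendsto (fun x => x * ρ x) (𝓝[>] 0) (𝓝 1)

/-- `γ₀` and `F₀` are the leading terms at `x = 0` of `γ̃_{ij} = x² γ_{ij}` and of the field
strength `F_{ij}` induced on the surfaces of constant `x`. -/
def IsLeadingData (ρ : ℝ → ℝ) (c : Idx k p → ℝ) (γ₀ : MetricField (BIdx k p) ℝ)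
    (F₀ : TensorField (BIdx k p) ℝ 2) : Prop :=
  (∀ y i j, Tendsto (fun x => x ^ 2 * inducedMetric B.metric (ρ x) y i j) (𝓝[>] 0)
      (𝓝 (γ₀ y i j))) ∧
  (∀ y i, Tendsto (fun x => inducedField (fieldStrength (B.potential c)) (ρ x) y i) (𝓝[>] 0)
      (𝓝 (F₀ y i)))

/-- The flat metric `-dt²/ℓ² + ∑ dφ_i² + dΩ²`. -/
def flatBoundaryMetric : MetricField (BIdx k p) ℝ := fun _ =>
  Matrix.diagonal (Sum.elim (fun _ => -1 / B.ℓ ^ 2) (fun _ => 1))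

section Log

variable (S : Set (BIdx k p → ℝ)) (γ : MetricField (BIdx k p) ℝ) (F : TensorField (BIdx k p) ℝ 2)

/-- The Weyl-anomaly logarithmic divergence for `n = 4`. -/
def logWeyl4 (ε : ℝ) : ℝ :=
  -(B.ℓ ^ 3 / (64 * Real.pi)) * Real.log ε *
    ∫ y in S, volDensity γ y * (normSq2 γ (ricci γ) y - 1 / 3 * scalarCurv γ y ^ 2)

/-- The Maxwell-field logarithmic divergence for `n = 4`. -/
def logEM4 (ε : ℝ) : ℝ :=
  B.ℓ / (64 * Real.pi) * Real.log ε * ∫ y in S, volDensity γ y * normSq2 γ F y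

/-- The Weyl-anomaly logarithmic divergence for `n = 6`. -/
def logWeyl6 (ε : ℝ) : ℝ :=
  B.ℓ ^ 3 / (8 ^ 4 * Real.pi) * Real.log ε *
    ∫ y in S, volDensity γ y *
      (3 / 50 * scalarCurv γ y ^ 3
        + (∑ i, ∑ j, ∑ k, ∑ l,
            raise2 γ (ricci γ) y i j * raise2 γ (ricci γ) y k l * riemannDown γ y ![i, j, k, l])
        - 1 / 2 * scalarCurv γ y * normSq2 γ (ricci γ) y
        + 1 / 5 * (∑ i, ∑ j, raise2 γ (ricci γ) y i j *
            covD γ (covD γ (ofScalar (scalarCurv γ))) y ![i, j])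
        - 1 / 2 * (∑ i, ∑ j, raise2 γ (ricci γ) y i j * box γ (ricci γ) y ![i, j])
        + 1 / 20 * scalarCurv γ y * box γ (ofScalar (scalarCurv γ)) y ![])

/-- The Maxwell-field logarithmic divergence for `n = 6`. -/
def logEM6 (ε : ℝ) : ℝ :=
  B.ℓ ^ 3 / (8 * Real.pi) * Real.log ε *
    ∫ y in S, volDensity γ y *
      (1 / 16 * scalarCurv γ y * normSq2 γ F y
        - 1 / 8 * (∑ i, ∑ j, ∑ l, ∑ k, raise2 γ (ricci γ) y i j * (γ y)⁻¹ l k *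
            F y ![i, k] * F y ![j, l])
        + 1 / 64 * (∑ i, ∑ j, raise2 γ F y i j *
            ∑ k, ∑ l, (γ y)⁻¹ k l * (covD γ (covD γ F) y ![j, l, k, i]
              - covD γ (covD γ F) y ![i, l, k, j])))

/-- The logarithmic divergence `ln ε ∫ √|γ| L` of a local invariant `L` of `γ` and `F`. -/
def logLocal (L : LocalExpr 0) (ε : ℝ) : ℝ :=
  Real.log ε * ∫ y in S, volDensity γ y * L.eval γ F y ![]

end Log

/-- The counterterm `ℓ/(256π) ∫ √γ (n-8)/(n-4) (F_{ij})²` of the electromagnetic field (for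
`n > 4`) on `r = R`, with `F_{ij}` the field induced on the boundary. -/
def emCounterterm (Y : Set (Fin p → ℝ)) (rp : ℝ) (c : Idx k p → ℝ) (R : ℝ) : ℂ :=
  ((B.ℓ / (256 * Real.pi) : ℝ) : ℂ) * ∫ y in B.bdryRegion Y rp,
    volDensity (B.cutoffMetric R) y * (((n - 8) / (n - 4) : ℝ) : ℂ) *
      normSq2 (B.cutoffMetric R) (inducedField (fieldStrength (B.euclPotential c)) R) y

/-- The same counterterm with the full bulk field strength restricted to `r = R`. -/
def emCountertermBulk (Y : Set (Fin p → ℝ)) (rp : ℝ) (c : Idx k p → ℝ) (R : ℝ) : ℂ :=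
  ((B.ℓ / (256 * Real.pi) : ℝ) : ℂ) * ∫ y in B.bdryRegion Y rp,
    volDensity (B.cutoffMetric R) y * (((n - 8) / (n - 4) : ℝ) : ℂ) *
      normSq2 B.euclMetric (fieldStrength (B.euclPotential c)) (atRadius R y)

end Brane

end BlackBrane

end

/-! Put ω = Ξ dt − ∑ a_i dφ_i and η = −dt²/ℓ² + ∑ dφ_i² + dΩ². Lagrange's identity and the
definition of Ξ collapse the metric to dr²/f + r² η + (r²/ℓ² − f) ω⊗ω (`Brane.metric_eq`), with
η⁻¹(ω, ω) = −ℓ² whatever the rotation (`Brane.euclOmega_norm`). On the Euclidean section this is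
dr²/f + r² S − f W with constant S and W of complementary ranks, so scalar curvature, extrinsic
trace, volume and F² do not see the rotation parameters.

The metric on r = R is constant. Every curvature counterterm therefore vanishes, the arbitrary one
included (`LocalExpr.eval_const_zero`), and only the volume term survives. The other densities
depend on r alone: √g = r^(n-1), the scalar curvature is −f'' − 2(n−1)f'/r − (n−1)(n−2)f/r²
(`WarpedData.IsMetric.scalarCurv_eq`), and F² = −(n−1)(n−2)q²/r^(2n-2). Integration gives the action
exactly at each cutoff (`Brane.IsOuterHorizon.actionGC_eq`); its only R-dependent part is
proportional to R^(n-1)√f/ℓ − Rⁿ/ℓ², which tends to −m/2, and f(r₊) = 0 eliminates m. In the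
canonical case the raised ω is a multiple of χ, so the boundary term sees the gauge only through
A(χ), which regularity at the horizon fixes.

For the logarithms, x = exp(−U(r)) with U' = 1/(ℓ√f) and U − log r → 0 is an asymptotic coordinate.
Since x r → 1 and the coefficient of ω⊗ω tends to zero, x²γ → η; and F has only components F_{ri},
so its pull-back is zero. The leading data are flat and field-free, and every local invariant of
them vanishes. -/

namespace BlackBrane

/-! ### Constant metrics: curvature and local invariants vanish -/

section ConstantMetric

variable {ι : Type*} [DecidableEq ι] {𝕜 : Type*} [RCLike 𝕜]

@[simp] lemma pd_const (i : ι) (a : 𝕜) (x : ι → ℝ) : pd i (fun _ => a) x = 0 := by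
  simp [pd]

variable [Fintype ι]

@[simp] lemma christoffel_const (M : Matrix ι ι 𝕜) (x : ι → ℝ) (a b c : ι) :
    christoffel (fun _ => M) x a b c = 0 := by
  simp [christoffel]

@[simp] lemma riemann_const (M : Matrix ι ι 𝕜) (x : ι → ℝ) (a b c d : ι) :
    riemann (fun _ => M) x a b c d = 0 := by
  simp [riemann]

@[simp] lemma riemannDown_const (M : Matrix ι ι 𝕜) : riemannDown (fun _ => M) = 0 := by
  ext x i
  simp [riemannDown]

@[simp] lemma ricci_const (M : Matrix ι ι 𝕜) : ricci (fun _ => M) = 0 := by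
  ext x i
  simp [ricci]

@[simp] lemma scalarCurv_const (M : Matrix ι ι 𝕜) : scalarCurv (fun _ => M) = 0 := by
  ext x
  simp [scalarCurv]

@[simp] lemma covD_zero (g : MetricField ι 𝕜) {s : ℕ} : covD g (0 : TensorField ι 𝕜 s) = 0 := by
  ext x i
  simp [covD]

@[simp] lemma contract_zero (g : MetricField ι 𝕜) {s : ℕ} :
    contract g (0 : TensorField ι 𝕜 (s + 2)) = 0 := by
  ext x i
  simp [contract]

@[simp] lemma box_zero (g : MetricField ι 𝕜) {s : ℕ} : box g (0 : TensorField ι 𝕜 s) = 0 := by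
  simp [box]

@[simp] lemma raise2_zero (g : MetricField ι 𝕜) (x : ι → ℝ) (a b : ι) :
    raise2 g 0 x a b = 0 := by
  simp [raise2]

@[simp] lemma normSq2_zero (g : MetricField ι 𝕜) (x : ι → ℝ) : normSq2 g 0 x = 0 := by
  simp [normSq2]

/-- On a constant metric without field, every local tensor expression vanishes. -/
lemma LocalExpr.eval_const_zero (M : Matrix ι ι 𝕜) {s : ℕ} (e : LocalExpr s) :
    e.eval (fun _ => M) 0 = 0 := by
  -- The grammar has no constant leaf: both leaves vanish here and each constructor preserves zero.
  -- For a product one vanishing factor is enough.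
  induction e with
  | riem => simp [LocalExpr.eval]
  | field => rfl
  | covD e ih => simp [LocalExpr.eval, ih]
  | mul e₁ e₂ ih₁ ih₂ => ext; simp [LocalExpr.eval, ih₁]
  | perm σ e ih => ext; simp [LocalExpr.eval, ih]
  | contract e ih => simp [LocalExpr.eval, ih]
  | add e₁ e₂ ih₁ ih₂ => ext; simp [LocalExpr.eval, ih₁, ih₂]
  | smul c e ih => ext; simp [LocalExpr.eval, ih]

end ConstantMetric

/-! ### Curvature of dr²/f + r² S − f W -/

section Warped

variable {ι : Type*} [DecidableEq ι]

/-- A radial derivative sees only nearby radii, so openness of `O` lets identities valid outside the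
horizon be differentiated. -/
lemma pd_radial {O : Set ℝ} (hO : IsOpen O) {u : (Unit ⊕ ι → ℝ) → ℂ} {U : ℝ → ℂ}
    (h : ∀ y, y (Sum.inl ()) ∈ O → u y = U (y (Sum.inl ()))) {x : Unit ⊕ ι → ℝ}
    (hx : x (Sum.inl ()) ∈ O) : pd (Sum.inl ()) u x = deriv U (x (Sum.inl ())) := by
  refine Filter.EventuallyEq.deriv_eq ?_
  filter_upwards [hO.mem_nhds hx] with s hs
  rw [h _ (by simpa using hs)]
  simp

/-- Moving a transverse coordinate leaves the radius fixed, so `O` need not be open here. -/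
lemma pd_transverse {𝕜 : Type*} [RCLike 𝕜] {O : Set ℝ} {u : (Unit ⊕ ι → ℝ) → 𝕜} {U : ℝ → 𝕜}
    (h : ∀ y, y (Sum.inl ()) ∈ O → u y = U (y (Sum.inl ()))) {x : Unit ⊕ ι → ℝ}
    (hx : x (Sum.inl ()) ∈ O) (i : ι) : pd (Sum.inr i) u x = 0 := by
  have : (fun s : ℝ => u (Function.update x (Sum.inr i) s)) = fun _ => U (x (Sum.inl ())) := by
    funext s
    rw [h _ (by simpa using hx)]
    simp
  simp [pd, this]

variable [Fintype ι]

/-- Data of a metric `dr²/f + r² S - f W` with constant matrices `S` and `W`, of complementary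
ranks `d` and `1`: `S'` and `V` are the inverses of `S` and `W` on complementary subspaces. -/
structure WarpedData (ι : Type*) [Fintype ι] [DecidableEq ι] where
  S : Matrix ι ι ℂ
  W : Matrix ι ι ℂ
  S' : Matrix ι ι ℂ
  V : Matrix ι ι ℂ
  d : ℂ
  symmS : S.transpose = S
  symmW : W.transpose = W
  symmS' : S'.transpose = S'
  symmV : V.transpose = V
  SW : S' * W = 0
  VS : V * S = 0
  add : S' * S + V * W = 1
  traceS : (S' * S).trace = d
  traceW : (V * W).trace = 1

namespace WarpedData

variable (D : WarpedData ι) (f : ℝ → ℝ)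

/-- The metric of the surfaces of constant `r`. -/
def fibre (r : ℝ) : Matrix ι ι ℂ := (r : ℂ) ^ 2 • D.S - (f r : ℂ) • D.W

/-- The inverse metric of the surfaces of constant `r`. -/
noncomputable def fibreInv (r : ℝ) : Matrix ι ι ℂ := ((r : ℂ) ^ 2)⁻¹ • D.S' - (f r : ℂ)⁻¹ • D.V

lemma SV : D.S * D.V = 0 := by
  rw [← D.symmS, ← D.symmV, ← Matrix.transpose_mul, D.VS, Matrix.transpose_zero]

lemma WS' : D.W * D.S' = 0 := by
  rw [← D.symmW, ← D.symmS', ← Matrix.transpose_mul, D.SW, Matrix.transpose_zero]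

/-- By `add`, `S' * S` is the identity less `V * W`, and `S` annihilates `V`. Together with `WVW`
this makes `S' * S` and `V * W` complementary projections. -/
lemma SS'S : D.S * (D.S' * D.S) = D.S := by
  rw [eq_sub_of_add_eq D.add, mul_sub, ← mul_assoc, D.SV]
  simp

lemma WVW : D.W * (D.V * D.W) = D.W := by
  rw [eq_sub_of_add_eq' D.add, mul_sub, ← mul_assoc D.W, D.WS']
  simp

lemma fibreInv_mul {r : ℝ} (hr : r ≠ 0) (hf : f r ≠ 0) : D.fibreInv f r * D.fibre f r = 1 := by
  have h1 : (r : ℂ) ^ 2 ≠ 0 := by simp [hr]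
  have h2 : (f r : ℂ) ≠ 0 := by simp [hf]
  simp only [fibreInv, fibre, sub_mul, mul_sub, Matrix.smul_mul, Matrix.mul_smul, D.SW, D.VS,
    smul_smul, mul_inv_cancel₀ h1, mul_inv_cancel₀ h2]
  simp [D.add]

/-- The metric `dr²/f + r² S - f W`. -/
noncomputable def bulk (r : ℝ) : Matrix (Unit ⊕ ι) (Unit ⊕ ι) ℂ :=
  Matrix.fromBlocks (Matrix.of fun _ _ => (f r : ℂ)⁻¹) 0 0 (D.fibre f r)

lemma inv_bulk {r : ℝ} (hr : r ≠ 0) (hf : f r ≠ 0) :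
    (D.bulk f r)⁻¹ = Matrix.fromBlocks (Matrix.of fun _ _ => (f r : ℂ)) 0 0 (D.fibreInv f r) := by
  have h2 : (f r : ℂ) ≠ 0 := by simp [hf]
  refine Matrix.inv_eq_left_inv ?_
  rw [bulk, Matrix.fromBlocks_multiply, D.fibreInv_mul f hr hf]
  have : (Matrix.of fun (_ _ : Unit) => (f r : ℂ)) * (Matrix.of fun _ _ => (f r : ℂ)⁻¹) = 1 := by
    ext
    simp [Matrix.mul_apply, h2]
  simp [this]

/-- Ricci and extrinsic curvature are combinations of `S` and `W` along the fibre; this trace and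
the next one perform their contraction. -/
lemma trace_fibreInv_S {r : ℝ} : (D.fibreInv f r * D.S).trace = D.d / (r : ℂ) ^ 2 := by
  simp [fibreInv, sub_mul, D.VS, D.traceS, div_eq_inv_mul]

lemma trace_fibreInv_W {r : ℝ} : (D.fibreInv f r * D.W).trace = -1 / (f r : ℂ) := by
  simp [fibreInv, sub_mul, D.SW, D.traceW, div_eq_inv_mul]

variable (f1 f2 : ℝ → ℝ)

/-- `Γ^r_{ij}`. -/
noncomputable def gammaR (r : ℝ) : Matrix ι ι ℂ :=
  (-(f r : ℂ) * r) • D.S + ((f r : ℂ) * f1 r / 2) • D.W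

/-- `Γ^i_{rj}`. -/
noncomputable def gammaK (r : ℝ) : Matrix ι ι ℂ :=
  (r : ℂ)⁻¹ • (D.S' * D.S) + ((f1 r : ℂ) / (2 * f r)) • (D.V * D.W)

/-- The Christoffel symbols of `dr²/f + r² S - f W`. -/
noncomputable def gamma : Unit ⊕ ι → Unit ⊕ ι → Unit ⊕ ι → ℝ → ℂ
  | .inl _, .inl _, .inl _, r => -f1 r / (2 * f r)
  | .inl _, .inr i, .inr j, r => D.gammaR f f1 r i j
  | .inr i, .inl _, .inr j, r => D.gammaK f f1 r i j
  | .inr i, .inr j, .inl _, r => D.gammaK f f1 r i j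
  | _, _, _, _ => 0

lemma trace_gammaK {r : ℝ} : (D.gammaK f f1 r).trace = D.d / r + f1 r / (2 * f r) := by
  simp [gammaK, D.traceS, D.traceW]
  ring

/-- `S' * S` and `V * W` are idempotents with zero products, so squaring acts on the two
coefficients separately. -/
lemma gammaK_sq {r : ℝ} : D.gammaK f f1 r * D.gammaK f f1 r =
    ((r : ℂ)⁻¹ ^ 2) • (D.S' * D.S) + ((f1 r : ℂ) / (2 * f r)) ^ 2 • (D.V * D.W) := by
  have h1 : D.S' * D.S * (D.V * D.W) = 0 := by
    rw [mul_assoc, ← mul_assoc D.S, D.SV]; simp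
  have h2 : D.V * D.W * (D.S' * D.S) = 0 := by
    rw [mul_assoc, ← mul_assoc D.W, D.WS']; simp
  have h3 : D.S' * D.S * (D.S' * D.S) = D.S' * D.S := by rw [mul_assoc, D.SS'S]
  have h4 : D.V * D.W * (D.V * D.W) = D.V * D.W := by rw [mul_assoc, D.WVW]
  simp only [gammaK, add_mul, mul_add, Matrix.smul_mul, Matrix.mul_smul, h1, h2, h3, h4, smul_smul]
  simp [sq]

lemma trace_gammaK_sq {r : ℝ} : (D.gammaK f f1 r * D.gammaK f f1 r).trace =
    D.d / r ^ 2 + ((f1 r : ℂ) / (2 * f r)) ^ 2 := by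
  rw [gammaK_sq]
  simp [D.traceS, D.traceW]
  ring

lemma gammaR_mul_gammaK {r : ℝ} (hr : r ≠ 0) (hf : f r ≠ 0) :
    D.gammaR f f1 r * D.gammaK f f1 r = (-(f r : ℂ)) • D.S + ((f1 r : ℂ) ^ 2 / 4) • D.W := by
  have hr' : (r : ℂ) ≠ 0 := by simp [hr]
  have hf' : (f r : ℂ) ≠ 0 := by simp [hf]
  have h1 : D.S * (D.V * D.W) = 0 := by rw [← mul_assoc, D.SV]; simp
  have h2 : D.W * (D.S' * D.S) = 0 := by rw [← mul_assoc, D.WS']; simp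
  simp only [gammaR, gammaK, add_mul, mul_add, Matrix.smul_mul, Matrix.mul_smul, h1, h2, D.SS'S,
    D.WVW, smul_smul, smul_zero, add_zero, zero_add]
  congr 2 <;> field_simp
  norm_num

/-- `g` is the metric `dr²/f + r² S - f W` over the open set `O` of radii, and `f1`, `f2` are the
first two derivatives of `f`. -/
structure IsMetric (O : Set ℝ) (g : MetricField (Unit ⊕ ι) ℂ) : Prop where
  isOpen : IsOpen O
  pos : ∀ r ∈ O, 0 < r
  fpos : ∀ r ∈ O, 0 < f r
  deriv1 : ∀ r ∈ O, HasDerivAt f (f1 r) r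
  deriv2 : ∀ r ∈ O, HasDerivAt f1 (f2 r) r
  eq_bulk : ∀ y, y (Sum.inl ()) ∈ O → g y = D.bulk f (y (Sum.inl ()))

namespace IsMetric

variable {D f f1 f2} {O : Set ℝ} {g : MetricField (Unit ⊕ ι) ℂ} (h : D.IsMetric f f1 f2 O g)
include h

lemma pd_inr {x : Unit ⊕ ι → ℝ} (hx : x (Sum.inl ()) ∈ O) (i : ι) (a b : Unit ⊕ ι) :
    pd (Sum.inr i) (fun y => g y a b) x = 0 :=
  pd_transverse (U := fun r => D.bulk f r a b) (fun y hy => by rw [h.eq_bulk y hy]) hx i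

lemma pd_inl {x : Unit ⊕ ι → ℝ} (hx : x (Sum.inl ()) ∈ O) (a b : Unit ⊕ ι) :
    pd (Sum.inl ()) (fun y => g y a b) x = deriv (fun r => D.bulk f r a b) (x (Sum.inl ())) :=
  pd_radial h.isOpen (U := fun r => D.bulk f r a b) (fun y hy => by rw [h.eq_bulk y hy]) hx

lemma deriv_fibre {r : ℝ} (hr : r ∈ O) (i j : ι) :
    deriv (fun r => D.fibre f r i j) r = 2 * r * D.S i j - f1 r * D.W i j := by
  have h1 := (h.deriv1 r hr).ofReal_comp
  have h2 := ((hasDerivAt_id r).ofReal_comp).pow 2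
  have := (h2.mul_const (D.S i j)).sub (h1.mul_const (D.W i j))
  exact HasDerivAt.deriv (f := fun r => D.fibre f r i j) (this.congr_deriv (by simp))

lemma deriv_inv {r : ℝ} (hr : r ∈ O) :
    deriv (fun r => (f r : ℂ)⁻¹) r = -(f1 r : ℂ) / f r ^ 2 :=
  ((h.deriv1 r hr).ofReal_comp.fun_inv (by simpa using (h.fpos r hr).ne')).deriv

lemma inv_eq {x : Unit ⊕ ι → ℝ} (hx : x (Sum.inl ()) ∈ O) :
    (g x)⁻¹ = Matrix.fromBlocks (Matrix.of fun _ _ => (f (x (Sum.inl ())) : ℂ)) 0 0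
      (D.fibreInv f (x (Sum.inl ()))) := by
  rw [h.eq_bulk x hx, D.inv_bulk f (h.pos _ hx).ne' (h.fpos _ hx).ne']

/-- `gammaK` is half the logarithmic derivative γ⁻¹ ∂_r γ of the fibre metric, which is what the
Christoffel formula produces in the mixed components. -/
lemma fibreInv_mul_deriv {r : ℝ} (hr : r ∈ O) (i j : ι) :
    ∑ e, D.fibreInv f r i e * (2 * r * D.S e j - f1 r * D.W e j) = 2 * D.gammaK f f1 r i j := by
  have hr' : (r : ℂ) ≠ 0 := by simpa using (h.pos r hr).ne'
  have hf' : (f r : ℂ) ≠ 0 := by simpa using (h.fpos r hr).ne'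
  have : D.fibreInv f r * ((2 * r : ℂ) • D.S - (f1 r : ℂ) • D.W) = (2 : ℂ) • D.gammaK f f1 r := by
    simp only [fibreInv, gammaK, sub_mul, mul_sub, Matrix.smul_mul, Matrix.mul_smul, D.SW, D.VS,
      smul_smul, smul_zero, sub_zero, zero_sub, smul_add, sub_neg_eq_add]
    congr 2 <;> field_simp
  simpa [Matrix.mul_apply] using congrFun (congrFun this i) j

lemma christoffel_eq {x : Unit ⊕ ι → ℝ} (hx : x (Sum.inl ()) ∈ O) (a b c : Unit ⊕ ι) :
    christoffel g x a b c = D.gamma f f1 a b c (x (Sum.inl ())) := by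
  have hf' : (f (x (Sum.inl ())) : ℂ) ≠ 0 := by simpa using (h.fpos _ hx).ne'
  have hS : ∀ i j, D.S i j = D.S j i := fun i j => congrFun (congrFun D.symmS j) i
  have hW : ∀ i j, D.W i j = D.W j i := fun i j => congrFun (congrFun D.symmW j) i
  -- Of the eight index blocks, `simp` closes all but Γ^r_{rr}, Γ^r_{ij}, Γ^i_{rj} and Γ^i_{jr}.
  rcases a with ⟨⟩ | a <;> rcases b with ⟨⟩ | b <;> rcases c with ⟨⟩ | c <;>
    simp [christoffel, h.inv_eq hx, Fintype.sum_sum_type, h.pd_inr hx, h.pd_inl hx, gamma, bulk,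
      h.deriv_fibre hx, h.deriv_inv hx]
  · field_simp
  · simp [gammaR]; ring
  · rw [h.fibreInv_mul_deriv hx]; ring
  · rw [h.fibreInv_mul_deriv hx]; ring

lemma pd_christoffel_inr {x : Unit ⊕ ι → ℝ} (hx : x (Sum.inl ()) ∈ O) (i : ι)
    (a b c : Unit ⊕ ι) : pd (Sum.inr i) (fun y => christoffel g y a b c) x = 0 :=
  pd_transverse (fun _ hy => h.christoffel_eq hy a b c) hx i

lemma pd_christoffel_inl {x : Unit ⊕ ι → ℝ} (hx : x (Sum.inl ()) ∈ O) (a b c : Unit ⊕ ι) :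
    pd (Sum.inl ()) (fun y => christoffel g y a b c) x =
      deriv (D.gamma f f1 a b c) (x (Sum.inl ())) :=
  pd_radial h.isOpen (fun _ hy => h.christoffel_eq hy a b c) hx

lemma deriv_gammaR {r : ℝ} (hr : r ∈ O) (i j : ι) :
    deriv (fun r => D.gammaR f f1 r i j) r = -(f1 r * r + f r) * D.S i j
      + (f1 r ^ 2 + f r * f2 r) / 2 * D.W i j := by
  have h1 := (h.deriv1 r hr).ofReal_comp
  have h2 := (h.deriv2 r hr).ofReal_comp
  have h0 := (hasDerivAt_id r).ofReal_comp
  have := ((h1.neg.mul h0).mul_const (D.S i j)).add (((h1.mul h2).div_const 2).mul_const (D.W i j))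
  refine HasDerivAt.deriv (f := fun r => D.gammaR f f1 r i j) (this.congr_deriv ?_)
  simp
  ring

lemma deriv_gammaK_trace {r : ℝ} (hr : r ∈ O) :
    ∑ i, deriv (fun r => D.gammaK f f1 r i i) r =
      -D.d / r ^ 2 + (f2 r * f r - f1 r ^ 2) / (2 * f r ^ 2) := by
  have hr' : (r : ℂ) ≠ 0 := by simpa using (h.pos r hr).ne'
  have hf' : (f r : ℂ) ≠ 0 := by simpa using (h.fpos r hr).ne'
  have h1 := (h.deriv1 r hr).ofReal_comp
  have h2 := (h.deriv2 r hr).ofReal_comp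
  have h0 := ((hasDerivAt_id r).ofReal_comp).fun_inv (by simpa using hr')
  have h3 := h2.fun_div (h1.const_mul (2 : ℂ)) (by simpa using hf')
  have key : ∀ i, deriv (fun r => D.gammaK f f1 r i i) r =
      (-1 / (r : ℂ) ^ 2) * (D.S' * D.S) i i +
      ((f2 r * f r - f1 r ^ 2) / (2 * f r ^ 2)) * (D.V * D.W) i i := by
    intro i
    have := (h0.mul_const ((D.S' * D.S) i i)).add (h3.mul_const ((D.V * D.W) i i))
    refine HasDerivAt.deriv (f := fun r => D.gammaK f f1 r i i) (this.congr_deriv ?_)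
    simp only [id, Complex.ofReal_one]
    congr 2
    field_simp
  have t1 : ∑ i, (D.S' * D.S) i i = D.d := D.traceS
  have t2 : ∑ i, (D.V * D.W) i i = 1 := D.traceW
  simp only [key, Finset.sum_add_distrib, ← Finset.mul_sum, t1, t2]
  ring

/-- With K = Γ^i_{rj}, a function of r alone, this is the Riccati-type expression −∂_r tr K +
Γ^r_{rr} tr K − tr K². -/
lemma ricci_inl {x : Unit ⊕ ι → ℝ} (hx : x (Sum.inl ()) ∈ O) :
    ricci g x ![Sum.inl (), Sum.inl ()] =
      -∑ i, deriv (fun r => D.gammaK f f1 r i i) (x (Sum.inl ()))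
      + (D.gammaK f f1 (x (Sum.inl ()))).trace *
        (-f1 (x (Sum.inl ())) / (2 * f (x (Sum.inl ()))))
      - (D.gammaK f f1 (x (Sum.inl ())) * D.gammaK f f1 (x (Sum.inl ()))).trace := by
  have e1 : ∀ i, D.gamma f f1 (Sum.inr i) (Sum.inr i) (Sum.inl ()) =
    fun r => D.gammaK f f1 r i i := fun i => rfl
  have e2 : ∀ i, D.gamma f f1 (Sum.inr i) (Sum.inl ()) (Sum.inl ()) = fun r => 0 := fun i => rfl
  simp only [ricci, riemann, Matrix.cons_val_zero, Matrix.cons_val_one, Fintype.sum_sum_type,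
    Finset.univ_unique, Finset.sum_singleton, PUnit.default_eq_unit, h.pd_christoffel_inl hx,
    h.pd_christoffel_inr hx, h.christoffel_eq hx, e1]
  simp [gamma, Matrix.trace, Matrix.mul_apply, Finset.sum_add_distrib,
    Finset.sum_mul]
  ring

lemma ricci_inr {x : Unit ⊕ ι → ℝ} (hx : x (Sum.inl ()) ∈ O) (i j : ι) :
    ricci g x ![Sum.inr i, Sum.inr j] =
      deriv (fun r => D.gammaR f f1 r i j) (x (Sum.inl ()))
      + ((D.gammaK f f1 (x (Sum.inl ()))).trace - f1 (x (Sum.inl ())) / (2 * f (x (Sum.inl ()))))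
        * D.gammaR f f1 (x (Sum.inl ())) i j
      - (D.gammaR f f1 (x (Sum.inl ())) * D.gammaK f f1 (x (Sum.inl ()))) i j
      - (D.gammaR f f1 (x (Sum.inl ())) * D.gammaK f f1 (x (Sum.inl ()))) j i := by
  have hS : ∀ i j, D.S i j = D.S j i := fun i j => congrFun (congrFun D.symmS j) i
  have hW : ∀ i j, D.W i j = D.W j i := fun i j => congrFun (congrFun D.symmW j) i
  have hR : ∀ r i j, D.gammaR f f1 r i j = D.gammaR f f1 r j i := fun r i j => by
    simp [gammaR, hS i j, hW i j]
  have e1 : D.gamma f f1 (Sum.inl ()) (Sum.inr j) (Sum.inr i) =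
    fun r => D.gammaR f f1 r i j := funext fun r => hR r j i
  simp only [ricci, riemann, Matrix.cons_val_zero, Matrix.cons_val_one, Fintype.sum_sum_type,
    Finset.univ_unique, Finset.sum_singleton, PUnit.default_eq_unit, h.pd_christoffel_inl hx,
    h.pd_christoffel_inr hx, h.christoffel_eq hx, e1]
  simp [gamma, Matrix.trace, Matrix.mul_apply, Finset.sum_sub_distrib,
    ← Finset.sum_mul]
  simp only [hR _ _ i, mul_comm (D.gammaK f f1 _ _ _)]
  ring

lemma scalarCurv_eq {x : Unit ⊕ ι → ℝ} (hx : x (Sum.inl ()) ∈ O) :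
    scalarCurv g x = -f2 (x (Sum.inl ())) - 2 * D.d * f1 (x (Sum.inl ())) / x (Sum.inl ())
      - D.d * (D.d - 1) * f (x (Sum.inl ())) / x (Sum.inl ()) ^ 2 := by
  set r := x (Sum.inl ()) with hr
  have hr' : (r : ℂ) ≠ 0 := by simpa using (h.pos r hx).ne'
  have hf' : (f r : ℂ) ≠ 0 := by simpa using (h.fpos r hx).ne'
  have hS : ∀ i j, D.S i j = D.S j i := fun i j => congrFun (congrFun D.symmS j) i
  have hW : ∀ i j, D.W i j = D.W j i := fun i j => congrFun (congrFun D.symmW j) i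
  -- The fibre Ricci tensor lies in the span of `S` and `W`. Keeping α and β opaque lets the
  -- contraction use linearity and the two traces only.
  obtain ⟨α, β, hα, hβ, hRic⟩ : ∃ α β : ℂ, α = -f1 r * r + (1 - D.d) * f r ∧
      β = f r * f2 r / 2 + D.d * f r * f1 r / (2 * r) ∧
      ∀ i j, ricci g x ![Sum.inr i, Sum.inr j] = α * D.S j i + β * D.W j i := by
    refine ⟨_, _, rfl, rfl, fun i j => ?_⟩
    rw [h.ricci_inr hx, ← hr, D.gammaR_mul_gammaK f f1 (h.pos r hx).ne' (h.fpos r hx).ne',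
      h.deriv_gammaR hx, D.trace_gammaK]
    simp [gammaR, hS i j, hW i j]
    field_simp
    ring
  have hs : ∑ i, ∑ j, D.fibreInv f r i j * (α * D.S j i + β * D.W j i) =
      α * (D.d / (r : ℂ) ^ 2) + β * (-1 / (f r : ℂ)) := by
    rw [← D.trace_fibreInv_S f, ← D.trace_fibreInv_W f]
    simp only [Matrix.trace, Matrix.mul_apply, Matrix.diag, Finset.mul_sum,
      ← Finset.sum_add_distrib]
    exact Finset.sum_congr rfl fun i _ => Finset.sum_congr rfl fun j _ => by ring
  simp only [scalarCurv, h.inv_eq hx, Fintype.sum_sum_type, Finset.univ_unique,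
    Finset.sum_singleton, PUnit.default_eq_unit, Matrix.fromBlocks_apply₁₁,
    Matrix.fromBlocks_apply₁₂, Matrix.fromBlocks_apply₂₁, Matrix.fromBlocks_apply₂₂, hRic,
    Matrix.zero_apply, zero_mul, Finset.sum_const_zero, zero_add, add_zero, ← hr, hs,
    h.ricci_inl hx, h.deriv_gammaK_trace hx, D.trace_gammaK, D.trace_gammaK_sq, Matrix.of_apply]
  rw [hα, hβ]
  field_simp
  ring

lemma unitConormal_eq {x : Unit ⊕ ι → ℝ} (hx : x (Sum.inl ()) ∈ O) (μ : Unit ⊕ ι) :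
    unitConormal g (Sum.inl ()) x μ =
      if μ = Sum.inl () then (((√(f (x (Sum.inl ()))))⁻¹ : ℝ) : ℂ) else 0 := by
  simp [unitConormal, h.inv_eq hx, abs_of_pos (h.fpos _ hx)]

/-- The conormal is dr/√f and is constant along the fibre, so the tangential components are
Γ^r_{ij}/√f; only their trace contributes. -/
lemma extrinsicTrace_eq {x : Unit ⊕ ι → ℝ} (hx : x (Sum.inl ()) ∈ O) :
    extrinsicTrace g (Sum.inl ()) x = (√(f (x (Sum.inl ()))))⁻¹ *
      (-D.d * f (x (Sum.inl ())) / x (Sum.inl ()) - f1 (x (Sum.inl ())) / 2) := by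
  set r := x (Sum.inl ()) with hr
  have hr' : (r : ℂ) ≠ 0 := by simpa using (h.pos r hx).ne'
  have hf' : (f r : ℂ) ≠ 0 := by simpa using (h.fpos r hx).ne'
  have hs : ((√(f r) : ℝ) : ℂ) ^ 2 = f r := by
    rw [← Complex.ofReal_pow, Real.sq_sqrt (h.fpos r hx).le]
  have hs' : ((√(f r) : ℝ) : ℂ) ≠ 0 := by
    simpa using (Real.sqrt_pos.2 (h.fpos r hx)).ne'
  have hS : ∀ i j, D.S i j = D.S j i := fun i j => congrFun (congrFun D.symmS j) i
  have hW : ∀ i j, D.W i j = D.W j i := fun i j => congrFun (congrFun D.symmW j) i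
  have hn : ∀ μ, unitNormal g (Sum.inl ()) x μ = if μ = Sum.inl () then (√(f r) : ℂ) else 0 := by
    rintro (⟨⟩ | i)
    · simp [unitNormal, h.unitConormal_eq hx, h.inv_eq hx, ← hr]
      field_simp
      exact hs.symm
    · simp [unitNormal, h.unitConormal_eq hx, h.inv_eq hx, ← hr]
  have hpd : ∀ (i : ι) ν, pd (Sum.inr i) (fun y => unitConormal g (Sum.inl ()) y ν) x = 0 :=
    fun i ν => pd_transverse (U := fun r => if ν = Sum.inl () then (((√(f r))⁻¹ : ℝ) : ℂ) else 0)
      (fun y hy => h.unitConormal_eq hy ν) hx i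
  -- The projector removes the normal direction because n_r n^r = 1, so the radial derivative of the
  -- conormal never has to be computed.
  have hrr : ∀ ν, extrinsicCurv g (Sum.inl ()) x (Sum.inl ()) ν = 0 := by
    intro ν
    simp only [extrinsicCurv, Fintype.sum_sum_type, Finset.univ_unique, PUnit.default_eq_unit,
      Finset.sum_singleton, hn, h.unitConormal_eq hx]
    simp [← hr, hs']
  have hij : ∀ i j, extrinsicCurv g (Sum.inl ()) x (Sum.inr i) (Sum.inr j) =
      (√(f r) : ℂ)⁻¹ * (-(f r : ℂ) * r * D.S j i + f r * f1 r / 2 * D.W j i) := by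
    intro i j
    simp only [extrinsicCurv, Fintype.sum_sum_type, Finset.univ_unique, PUnit.default_eq_unit,
      Finset.sum_singleton, hn, h.unitConormal_eq hx, hpd, h.christoffel_eq hx]
    simp [← hr, gamma, gammaR, hS i j, hW i j]
    ring
  have hsum : ∑ i, ∑ j, D.fibreInv f r i j *
      ((√(f r) : ℂ)⁻¹ * (-(f r : ℂ) * r * D.S j i + f r * f1 r / 2 * D.W j i)) =
      (√(f r) : ℂ)⁻¹ * (-(f r : ℂ) * r * (D.d / (r : ℂ) ^ 2)
        + f r * f1 r / 2 * (-1 / (f r : ℂ))) := by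
    rw [← D.trace_fibreInv_S f, ← D.trace_fibreInv_W f]
    simp only [Matrix.trace, Matrix.mul_apply, Matrix.diag, Finset.mul_sum,
      ← Finset.sum_add_distrib]
    exact Finset.sum_congr rfl fun i _ => Finset.sum_congr rfl fun j _ => by ring
  simp only [extrinsicTrace, h.inv_eq hx, Fintype.sum_sum_type, Finset.univ_unique,
    Finset.sum_singleton, PUnit.default_eq_unit, Matrix.fromBlocks_apply₁₁,
    Matrix.fromBlocks_apply₁₂, Matrix.fromBlocks_apply₂₁, Matrix.fromBlocks_apply₂₂, hrr, hij,
    Matrix.zero_apply, zero_mul, mul_zero, Finset.sum_const_zero, zero_add, ← hr, hsum,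
    Complex.ofReal_inv]
  field_simp
  ring

end IsMetric

end WarpedData

end Warped

/-! ### Warped data from a diagonal metric and one covector -/

section LinearForm

variable {ι : Type*} [Fintype ι]

open Matrix in
lemma vecMulVec_mul_vecMulVec_of_norm {e ω : ι → ℂ} {L : ℂ} (hω : (e⁻¹ * ω) ⬝ᵥ ω = -L) :
    vecMulVec (e⁻¹ * ω) (e⁻¹ * ω) * vecMulVec ω ω = (-L) • vecMulVec (e⁻¹ * ω) ω := by
  ext i j
  simp only [Matrix.mul_apply, vecMulVec_apply, Matrix.smul_apply, smul_eq_mul, ← hω, dotProduct,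
    Finset.sum_mul]
  exact Finset.sum_congr rfl fun _ _ => by ring

variable [DecidableEq ι]

open Matrix in
lemma diagonal_inv_mul_vecMulVec (e ω : ι → ℂ) :
    diagonal e⁻¹ * vecMulVec ω ω = vecMulVec (e⁻¹ * ω) ω := by
  ext i j
  simp [diagonal_mul, vecMulVec_apply, mul_assoc]

open Matrix in
lemma vecMulVec_mul_diagonal {e : ι → ℂ} (he : ∀ i, e i ≠ 0) (ω v : ι → ℂ) :
    vecMulVec v (e⁻¹ * ω) * diagonal e = vecMulVec v ω := by
  ext i j
  have := he j
  simp only [mul_diagonal, vecMulVec_apply, Pi.mul_apply, Pi.inv_apply]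
  field_simp

open Matrix in
/-- The warped data `S = η + ω ⊗ ω / L`, `W = ω ⊗ ω` of a diagonal metric `η` and a covector `ω`
of norm `η⁻¹(ω, ω) = -L`. -/
noncomputable def WarpedData.ofForm (e ω : ι → ℂ) (L : ℂ) (he : ∀ i, e i ≠ 0) (hL : L ≠ 0)
    (hω : (e⁻¹ * ω) ⬝ᵥ ω = -L) : WarpedData ι :=
  -- With v = e⁻¹ω, the product `S' * S` is the projection 1 + v⊗ω/L, which kills v since ω(v) = −L;
  -- `V * W` is the complementary projection onto v.
  have hS : (diagonal e⁻¹ + L⁻¹ • vecMulVec (e⁻¹ * ω) (e⁻¹ * ω)) *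
      (diagonal e + L⁻¹ • vecMulVec ω ω) = 1 + L⁻¹ • vecMulVec (e⁻¹ * ω) ω := by
    have h3 : diagonal e⁻¹ * diagonal e = (1 : Matrix ι ι ℂ) := by
      rw [diagonal_mul_diagonal, ← diagonal_one]; congr 1; ext i; simp [he i]
    simp only [add_mul, mul_add, Matrix.smul_mul, Matrix.mul_smul, diagonal_inv_mul_vecMulVec,
      vecMulVec_mul_diagonal he, vecMulVec_mul_vecMulVec_of_norm hω, h3]
    match_scalars <;> field_simp
    ring
  have hV : ((L ^ 2)⁻¹ • vecMulVec (e⁻¹ * ω) (e⁻¹ * ω)) * vecMulVec ω ω =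
      (-L⁻¹) • vecMulVec (e⁻¹ * ω) ω := by
    rw [Matrix.smul_mul, vecMulVec_mul_vecMulVec_of_norm hω]
    match_scalars
    field_simp
  { S := diagonal e + L⁻¹ • vecMulVec ω ω
    W := vecMulVec ω ω
    S' := diagonal e⁻¹ + L⁻¹ • vecMulVec (e⁻¹ * ω) (e⁻¹ * ω)
    V := (L ^ 2)⁻¹ • vecMulVec (e⁻¹ * ω) (e⁻¹ * ω)
    d := Fintype.card ι - 1
    symmS := by simp [transpose_vecMulVec]
    symmW := by simp [transpose_vecMulVec]
    symmS' := by simp [transpose_vecMulVec]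
    symmV := by simp [transpose_vecMulVec]
    SW := by
      simp only [add_mul, Matrix.smul_mul, diagonal_inv_mul_vecMulVec,
        vecMulVec_mul_vecMulVec_of_norm hω]
      match_scalars
      field_simp
      ring
    VS := by
      simp only [mul_add, Matrix.smul_mul, Matrix.mul_smul, vecMulVec_mul_diagonal he,
        vecMulVec_mul_vecMulVec_of_norm hω]
      match_scalars
      field_simp
      ring
    add := by
      rw [hS, hV]
      module
    traceS := by
      rw [hS, trace_add, trace_smul, trace_vecMulVec, hω]
      simp [hL]
      ring
    traceW := by
      rw [hV, trace_smul, trace_vecMulVec, hω]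
      simp [hL] }

open Matrix in
-- The fibre metric is r²η plus (r²/L − f) ω⊗ω, and the rank-one determinant formula gives the
-- factor 1 − (r²/L − f) L/r² = f L/r².
lemma WarpedData.det_fibre_ofForm (e ω : ι → ℂ) (L : ℂ) (he : ∀ i, e i ≠ 0) (hL : L ≠ 0)
    (hω : (e⁻¹ * ω) ⬝ᵥ ω = -L) (f : ℝ → ℝ) {r : ℝ} (hr : r ≠ 0) :
    ((WarpedData.ofForm e ω L he hL hω).fibre f r).det =
      (r : ℂ) ^ (2 * Fintype.card ι) * (∏ i, e i) * (f r * L / (r : ℂ) ^ 2) := by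
  have hr' : (r : ℂ) ≠ 0 := by simp [hr]
  have : (WarpedData.ofForm e ω L he hL hω).fibre f r =
      diagonal (fun i => (r : ℂ) ^ 2 * e i) * (1 + replicateCol Unit
        (((r : ℂ) ^ 2)⁻¹ • (e⁻¹ * ω)) * replicateRow Unit (((r : ℂ) ^ 2 / L - f r) • ω)) := by
    ext i j
    rw [diagonal_mul]
    by_cases hij : i = j
    · subst hij
      simp [WarpedData.fibre, WarpedData.ofForm, vecMulVec_apply, Matrix.mul_apply]
      field_simp [he i]
      ring
    · simp [WarpedData.fibre, WarpedData.ofForm, vecMulVec_apply, Matrix.mul_apply, hij]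
      field_simp [he i]
  rw [this, det_mul, det_one_add_replicateCol_mul_replicateRow, det_diagonal]
  rw [smul_dotProduct, dotProduct_smul, dotProduct_comm, hω]
  simp [Finset.prod_mul_distrib, pow_mul]
  field_simp
  simp

end LinearForm

/-! ### Purely radial field strengths -/

section Maxwell

variable {ι : Type*} [Fintype ι] [DecidableEq ι]

lemma raise2_radial {g : MetricField (Unit ⊕ ι) ℂ} {x : Unit ⊕ ι → ℝ} {N : ℂ} {H : Matrix ι ι ℂ}
    (hg : (g x)⁻¹ = Matrix.fromBlocks (Matrix.of fun _ _ => N) 0 0 H)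
    {T : TensorField (Unit ⊕ ι) ℂ 2} {E : ι → ℂ}
    (h00 : T x ![Sum.inl (), Sum.inl ()] = 0) (h0 : ∀ i, T x ![Sum.inl (), Sum.inr i] = E i) :
    raise2 g T x (Sum.inl ()) (Sum.inl ()) = 0 ∧
      ∀ i, raise2 g T x (Sum.inl ()) (Sum.inr i) = N * (H.mulVec E) i := by
  constructor
  · simp [raise2, hg, Fintype.sum_sum_type, h00]
  · intro i
    simp [raise2, hg, Fintype.sum_sum_type, h0, Matrix.mulVec, dotProduct, Finset.mul_sum, mul_assoc]

/-- The orderings F_{ri} and F_{ir} contribute equally, whence the factor 2. -/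
lemma normSq2_radial {g : MetricField (Unit ⊕ ι) ℂ} {x : Unit ⊕ ι → ℝ} {N : ℂ} {H : Matrix ι ι ℂ}
    (hg : (g x)⁻¹ = Matrix.fromBlocks (Matrix.of fun _ _ => N) 0 0 H)
    {T : TensorField (Unit ⊕ ι) ℂ 2} {E : ι → ℂ}
    (h00 : T x ![Sum.inl (), Sum.inl ()] = 0) (hij : ∀ i j, T x ![Sum.inr i, Sum.inr j] = 0)
    (h0 : ∀ i, T x ![Sum.inl (), Sum.inr i] = E i)
    (h1 : ∀ i, T x ![Sum.inr i, Sum.inl ()] = -E i) :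
    normSq2 g T x = 2 * N * (E ⬝ᵥ H.mulVec E) := by
  have h2 : ∀ i, raise2 g T x (Sum.inr i) (Sum.inl ()) = -(N * (H.mulVec E) i) := by
    intro i
    simp [raise2, hg, Fintype.sum_sum_type, h1, Matrix.mulVec, dotProduct, Finset.mul_sum, mul_assoc,
      mul_left_comm N]
  obtain ⟨h3, h4⟩ := raise2_radial hg h00 h0
  simp [normSq2, Fintype.sum_sum_type, h00, hij, h0, h1, h2, h4, dotProduct, Finset.mul_sum,
    ← Finset.sum_add_distrib]
  exact Finset.sum_congr rfl fun i _ => by ring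

end Maxwell

/-! ### Normal form of the brane metric -/

namespace Brane

variable {n k p : ℕ} (B : Brane n k p)

/-- The coefficient `r²/ℓ² - f` of `(Ξ dt - ∑ a_i dφ_i)²` in the metric. -/
noncomputable def excess (r : ℝ) : ℝ := B.m / r ^ (n - 2) - B.q ^ 2 / r ^ (2 * n - 4)

lemma f_eq (r : ℝ) : B.f r = r ^ 2 / B.ℓ ^ 2 - B.excess r := by
  simp only [f, excess]; ring

lemma sum_sum_Ioi_of_symm {k : ℕ} (F : Fin k → Fin k → ℝ) (hs : ∀ i j, F i j = F j i)
    (h0 : ∀ i, F i i = 0) : ∑ i, ∑ j ∈ Finset.Ioi i, F i j = (∑ i, ∑ j, F i j) / 2 := by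
  have h1 : ∀ i, ∑ j, F i j = ∑ j ∈ Finset.Ioi i, F i j + ∑ j ∈ Finset.Iio i, F i j := by
    intro i
    have : (Finset.univ : Finset (Fin k)) = insert i (Finset.Ioi i ∪ Finset.Iio i) := by
      ext j; simp; omega
    rw [this, Finset.sum_insert (by simp), h0, zero_add, Finset.sum_union]
    rw [Finset.disjoint_left]
    intro j
    simp
    omega
  have h2 : ∑ i, ∑ j ∈ Finset.Iio i, F i j = ∑ i, ∑ j ∈ Finset.Ioi i, F i j := by
    rw [Finset.sum_comm' (t' := Finset.univ) (s' := fun j => Finset.Ioi j) (by simp)]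
    exact Finset.sum_congr rfl fun i _ => Finset.sum_congr rfl fun j _ => hs j i
  simp only [h1, Finset.sum_add_distrib, h2]
  ring

/-- Polarised Lagrange identity: over ordered pairs, the squares (a_i dφ_j − a_j dφ_i)² add up to
2(|a|² ∑ dφ_i² − (∑ a_i dφ_i)²). -/
lemma sum_sum_mul_wedge {k : ℕ} (a : Fin k → ℝ) (μ ν : Fin k) :
    ∑ i, ∑ j, ((if μ = j then a i else 0) - if μ = i then a j else 0) *
      ((if ν = j then a i else 0) - if ν = i then a j else 0) =
    2 * ((if μ = ν then ∑ i, a i ^ 2 else 0) - a μ * a ν) := by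
  have : ∀ i j, ((if μ = j then a i else 0) - if μ = i then a j else 0) *
      ((if ν = j then a i else 0) - if ν = i then a j else 0) =
      (if j = μ then (if j = ν then a i ^ 2 else 0) else 0)
      + (if i = μ then (if i = ν then a j ^ 2 else 0) else 0)
      - (if j = μ then (if i = ν then a j * a i else 0) else 0)
      - (if i = μ then (if j = ν then a j * a i else 0) else 0) := by
    intro i j
    simp only [@eq_comm _ μ, @eq_comm _ ν]
    split_ifs <;> ring
  simp only [this, Finset.sum_add_distrib, Finset.sum_sub_distrib]
  by_cases h : μ = ν
  · subst h; simp; ring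
  · simp [h]; ring

lemma omega_r (u : Unit) : B.omega (Sum.inl u) = 0 := by simp [omega, dx]

lemma omega_t (u : Unit) : B.omega (Sum.inr (Sum.inl u)) = B.Xi := by simp [omega, dx]

lemma omega_phi (i : Fin k) : B.omega (Idx.phi i) = -B.a i := by
  simp [omega, dx, Pi.single_apply]

lemma omega_flat (j : Fin p) : B.omega (Idx.flat j) = 0 := by
  simp [omega, dx]

lemma Xi_sq : B.Xi ^ 2 = 1 + ∑ i, B.a i ^ 2 / B.ℓ ^ 2 :=
  Real.sq_sqrt (by positivity)

lemma Xi_pos : 0 < B.Xi := Real.sqrt_pos.2 (by positivity)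

/-- The metric is `dr²/f + r² (-dt²/ℓ² + ∑ dφ_i² + dΩ²) + (r²/ℓ² - f) (Ξ dt - ∑ a_i dφ_i)²`. -/
lemma metric_eq (hℓ : 0 < B.ℓ) (x : Idx k p → ℝ) :
    B.metric x = Matrix.fromBlocks (Matrix.of fun _ _ => 1 / B.f (x Idx.r)) 0 0
      (x Idx.r ^ 2 • B.flatBoundaryMetric 0 +
        B.excess (x Idx.r) • Matrix.vecMulVec (fun b => B.omega (Sum.inr b))
          (fun b => B.omega (Sum.inr b))) := by
  have hℓ' := hℓ.ne'
  have hX := B.Xi_sq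
  have hexc : B.excess (x Idx.r) = x Idx.r ^ 2 / B.ℓ ^ 2 - B.f (x Idx.r) := by
    rw [f_eq]; ring
  have hI : ∀ μ ν : Idx k p, (∑ i, ∑ j ∈ Finset.Ioi i,
      sq (B.a i • dx (Idx.phi j) - B.a j • dx (Idx.phi i))) μ ν =
      (∑ i, ∑ j, (B.a i * dx (k := k) (p := p) (Idx.phi j) μ - B.a j * dx (Idx.phi i) μ) *
        (B.a i * dx (k := k) (p := p) (Idx.phi j) ν - B.a j * dx (Idx.phi i) ν)) / 2 := by
    intro μ ν
    rw [← sum_sum_Ioi_of_symm _ (by intros; ring) (by intros; ring)]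
    simp [Matrix.sum_apply, sq, Matrix.vecMulVec_apply]
  ext μ ν
  rcases μ with ⟨⟩ | ⟨⟩ | μ | μ <;> rcases ν with ⟨⟩ | ⟨⟩ | ν | ν <;>
    simp only [metric, Matrix.add_apply, Matrix.sub_apply, Matrix.smul_apply, hI] <;>
    simp [Matrix.sum_apply, sq, Matrix.vecMulVec_apply, dx, omega_r, omega_t, omega_phi, omega_flat,
      Pi.single_apply, flatBoundaryMetric, hexc]
  · have hX' : ∑ i, B.a i * B.a i = B.ℓ ^ 2 * (B.Xi ^ 2 - 1) := by
      rw [hX, ← Finset.sum_div]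
      simp only [← pow_two]
      field_simp
      ring
    rw [hX']
    field_simp
    ring
  · field_simp
    ring
  · field_simp
    ring
  -- In the angular block the squares give r² Ξ² δ and the wedges remove r² (Ξ² − 1) δ, leaving r² δ
  -- plus a multiple of a⊗a.
  · have hX' : ∑ i, B.a i ^ 2 = B.ℓ ^ 2 * (B.Xi ^ 2 - 1) := by
      rw [hX, ← Finset.sum_div]
      field_simp
      ring
    rw [sum_sum_mul_wedge, hX']
    by_cases h : μ = ν
    · subst h
      simp
      field_simp
      ring
    · simp [h]
      field_simp
      ring
  · by_cases h : μ = ν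
    · subst h; simp
    · simp [h]

end Brane

/-! ### The Euclidean section and closed forms of the densities -/

namespace Brane

variable {n k p : ℕ} (B : Brane n k p)

/-- The diagonal entries of the flat metric `dτ²/ℓ² + ∑ dφ_i² + dΩ²`. -/
noncomputable def euclDiag : BIdx k p → ℂ := Sum.elim (fun _ => 1 / (B.ℓ : ℂ) ^ 2) (fun _ => 1)

/-- The one-form `Ξ dt - ∑ a_i dφ_i` on the Euclidean section. -/
noncomputable def euclOmega (b : BIdx k p) : ℂ := wickFactor (Sum.inr b) * (B.omega (Sum.inr b) : ℂ)

variable {B}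

lemma euclDiag_ne_zero (hℓ : 0 < B.ℓ) (b : BIdx k p) : B.euclDiag b ≠ 0 := by
  rcases b with _ | b <;> simp [euclDiag, hℓ.ne']

lemma sum_a_sq (hℓ : 0 < B.ℓ) : ∑ i, B.a i ^ 2 = B.ℓ ^ 2 * (B.Xi ^ 2 - 1) := by
  have := hℓ.ne'
  rw [B.Xi_sq, ← Finset.sum_div]
  field_simp
  ring

/-- This is −ℓ²Ξ² + |a|² = −ℓ², the reason for the choice of Ξ; the rotation parameters drop out of
the norm of ω. -/
lemma euclOmega_norm (hℓ : 0 < B.ℓ) :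
    (B.euclDiag⁻¹ * B.euclOmega) ⬝ᵥ B.euclOmega = -((B.ℓ : ℂ) ^ 2) := by
  have h : ∑ i, (B.a i : ℂ) ^ 2 = (B.ℓ : ℂ) ^ 2 * ((B.Xi : ℂ) ^ 2 - 1) := by
    exact_mod_cast sum_a_sq hℓ
  simp only [dotProduct, Fintype.sum_sum_type, Pi.mul_apply, Pi.inv_apply, euclDiag, euclOmega,
    omega_t, omega_phi, omega_flat, wickFactor, Finset.univ_unique, Finset.sum_singleton,
    Sum.elim_inl, Sum.elim_inr]
  simp [← pow_two, h, mul_assoc]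
  linear_combination (B.Xi : ℂ) ^ 2 * (B.ℓ : ℂ) ^ 2 * Complex.I_sq

/-- The Euclidean metric as a warped metric. -/
noncomputable def warped (hℓ : 0 < B.ℓ) : WarpedData (BIdx k p) :=
  WarpedData.ofForm B.euclDiag B.euclOmega ((B.ℓ : ℂ) ^ 2) (euclDiag_ne_zero hℓ)
    (by simp [hℓ.ne']) (euclOmega_norm hℓ)

lemma warped_d (hℓ : 0 < B.ℓ) (hdim : n = 1 + k + p) : (warped hℓ).d = n - 1 := by
  subst hdim
  simp [warped, WarpedData.ofForm]
  ring

lemma euclMetric_eq (hℓ : 0 < B.ℓ) (x : Idx k p → ℝ) :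
    B.euclMetric x = (warped hℓ).bulk B.f (x Idx.r) := by
  have hℓ' : (B.ℓ : ℂ) ≠ 0 := by simp [hℓ.ne']
  have hexc : (B.f (x Idx.r) : ℂ) = x Idx.r ^ 2 / B.ℓ ^ 2 - B.excess (x Idx.r) := by
    rw [f_eq]; push_cast; ring
  ext μ ν
  rw [euclMetric, wickMetric, Matrix.of_apply, B.metric_eq hℓ]
  rcases μ with μ | μ <;> rcases ν with ν | ν
  · simp [WarpedData.bulk, wickFactor]
  · simp [WarpedData.bulk]
  · simp [WarpedData.bulk]
  · have hflat : wickFactor (Sum.inr μ) * wickFactor (Sum.inr ν) *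
        ((B.flatBoundaryMetric 0 μ ν : ℝ) : ℂ) = Matrix.diagonal B.euclDiag μ ν := by
      rcases μ with ⟨⟩ | μ <;> rcases ν with ⟨⟩ | ν
      · simp [wickFactor, flatBoundaryMetric, euclDiag]
        field_simp
      · simp [flatBoundaryMetric]
      · simp [flatBoundaryMetric]
      · by_cases h : μ = ν
        · subst h; simp [wickFactor, flatBoundaryMetric, euclDiag]
        · simp [flatBoundaryMetric, h]
    simp only [Matrix.fromBlocks_apply₂₂, WarpedData.bulk, WarpedData.fibre, warped,
      WarpedData.ofForm, Matrix.add_apply, Matrix.sub_apply, Matrix.smul_apply, smul_eq_mul,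
      Matrix.vecMulVec_apply, ← hflat, hexc, euclOmega]
    push_cast
    field_simp
    ring

/-- The independence of the boundary point is what makes the cutoff surface flat. -/
lemma cutoffMetric_eq (hℓ : 0 < B.ℓ) (R : ℝ) :
    B.cutoffMetric R = fun _ => (warped hℓ).fibre B.f R := by
  funext y
  ext i j
  simp [cutoffMetric, inducedMetric, euclMetric_eq hℓ, WarpedData.bulk, atRadius]

/-- The diagonal entries multiply to ℓ⁻², which cancels L = ℓ². The determinant is real although the
metric is complex. -/
lemma det_fibre (hℓ : 0 < B.ℓ) (hdim : n = 1 + k + p) {r : ℝ} (hr : r ≠ 0) :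
    ((warped hℓ).fibre B.f r).det = (((r ^ (n - 1)) ^ 2 * B.f r : ℝ) : ℂ) := by
  have hℓ' : (B.ℓ : ℂ) ≠ 0 := by simp [hℓ.ne']
  have hr' : (r : ℂ) ≠ 0 := by simp [hr]
  subst hdim
  rw [warped, WarpedData.det_fibre_ofForm _ _ _ _ _ _ _ hr]
  have h1 : 1 + k + p - 1 = k + p := by omega
  simp [euclDiag, h1]
  field_simp
  ring

lemma volDensity_cutoffMetric (hℓ : 0 < B.ℓ) (hdim : n = 1 + k + p) {R : ℝ} (hR : 0 < R)
    (hf : 0 < B.f R) (y : BIdx k p → ℝ) :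
    volDensity (B.cutoffMetric R) y = R ^ (n - 1) * √(B.f R) := by
  rw [volDensity, cutoffMetric_eq hℓ, det_fibre hℓ hdim hR.ne', Complex.norm_real,
    Real.norm_of_nonneg (by positivity), Real.sqrt_mul (by positivity), Real.sqrt_sq (by positivity)]

lemma volDensity_euclMetric (hℓ : 0 < B.ℓ) (hdim : n = 1 + k + p) {x : Idx k p → ℝ}
    (hr : 0 < x Idx.r) (hf : 0 < B.f (x Idx.r)) :
    volDensity B.euclMetric x = x Idx.r ^ (n - 1) := by
  have hf' : (B.f (x Idx.r) : ℂ) ≠ 0 := by simp [hf.ne']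
  have : (B.euclMetric x).det = (((x Idx.r ^ (n - 1)) ^ 2 : ℝ) : ℂ) := by
    rw [euclMetric_eq hℓ, WarpedData.bulk, Matrix.det_fromBlocks_zero₁₂, det_fibre hℓ hdim hr.ne']
    simp
    field_simp
  rw [volDensity, this, Complex.norm_real, Real.norm_of_nonneg (by positivity),
    Real.sqrt_sq (by positivity)]

variable (B) in
/-- The derivative of `f`. -/
noncomputable def f1 (r : ℝ) : ℝ :=
  2 * r / B.ℓ ^ 2 + (n - 2 : ℕ) * B.m / r ^ (n - 2 + 1)
    - (2 * n - 4 : ℕ) * B.q ^ 2 / r ^ (2 * n - 4 + 1)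

variable (B) in
/-- The second derivative of `f`. -/
noncomputable def f2 (r : ℝ) : ℝ :=
  2 / B.ℓ ^ 2 - (n - 2 : ℕ) * ((n - 2 : ℕ) + 1) * B.m / r ^ (n - 2 + 2)
    + (2 * n - 4 : ℕ) * ((2 * n - 4 : ℕ) + 1) * B.q ^ 2 / r ^ (2 * n - 4 + 2)

lemma hasDerivAt_const_div_pow (b : ℝ) (j : ℕ) {r : ℝ} (hr : r ≠ 0) :
    HasDerivAt (fun r => b / r ^ j) (-(j * b / r ^ (j + 1))) r := by
  have := (hasDerivAt_const r b).fun_div (hasDerivAt_pow j r) (pow_ne_zero j hr)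
  refine this.congr_deriv ?_
  rcases j with _ | j
  · simp
  · simp
    field_simp
    ring

lemma hasDerivAt_f {r : ℝ} (hr : r ≠ 0) : HasDerivAt B.f (B.f1 r) r := by
  have h1 := (hasDerivAt_pow 2 r).div_const (B.ℓ ^ 2)
  have := (h1.sub (hasDerivAt_const_div_pow B.m (n - 2) hr)).add
    (hasDerivAt_const_div_pow (B.q ^ 2) (2 * n - 4) hr)
  exact HasDerivAt.congr_deriv (f := B.f) this (by simp [f1]; ring)

lemma hasDerivAt_f1 {r : ℝ} (hr : r ≠ 0) : HasDerivAt B.f1 (B.f2 r) r := by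
  have h1 := ((hasDerivAt_id r).const_mul 2).div_const (B.ℓ ^ 2)
  have := (h1.add (hasDerivAt_const_div_pow ((n - 2 : ℕ) * B.m) (n - 2 + 1) hr)).sub
    (hasDerivAt_const_div_pow ((2 * n - 4 : ℕ) * B.q ^ 2) (2 * n - 4 + 1) hr)
  exact HasDerivAt.congr_deriv (f := B.f1) this (by simp [f2]; ring)

lemma IsOuterHorizon.isMetric {rp : ℝ} (h : B.IsOuterHorizon rp) (hℓ : 0 < B.ℓ) :
    (warped hℓ).IsMetric B.f B.f1 B.f2 (Set.Ioi rp) B.euclMetric where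
  isOpen := isOpen_Ioi
  pos _ hr := h.pos.trans hr
  fpos r hr := h.outside r hr
  deriv1 _ hr := hasDerivAt_f (h.pos.trans hr).ne'
  deriv2 _ hr := hasDerivAt_f1 (h.pos.trans hr).ne'
  eq_bulk y _ := euclMetric_eq hℓ y

variable {rp : ℝ} (h : B.IsOuterHorizon rp)
include h

/-- The mass term drops out: r^(-(n-2)) is annihilated by f ↦ f'' + 2(n−1)f'/r + (n−1)(n−2)f/r². -/
lemma IsOuterHorizon.scalarCurv_eq (hn : 3 ≤ n) (hdim : n = 1 + k + p) (hℓ : 0 < B.ℓ)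
    {x : Idx k p → ℝ} (hx : rp < x Idx.r) :
    scalarCurv B.euclMetric x = ((-(n * (n + 1)) / B.ℓ ^ 2
      - (n - 2) * (n - 3) * B.q ^ 2 / x Idx.r ^ (2 * n - 2) : ℝ) : ℂ) := by
  have hr : x Idx.r ≠ 0 := (h.pos.trans hx).ne'
  rw [(h.isMetric hℓ).scalarCurv_eq hx, warped_d hℓ hdim]
  clear hdim
  -- Writing n = N + 2 removes the truncated subtractions from the exponents.
  obtain ⟨N, rfl⟩ : ∃ N, n = N + 2 := ⟨n - 2, by omega⟩
  have h4 : 2 * (N + 2) - 4 = 2 * N := by omega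
  have h5 : 2 * (N + 2) - 2 = 2 * N + 2 := by omega
  have : -B.f2 (x Idx.r) - 2 * (((N + 2 : ℕ) : ℝ) - 1) * B.f1 (x Idx.r) / x Idx.r
      - (((N + 2 : ℕ) : ℝ) - 1) * ((((N + 2 : ℕ) : ℝ) - 1) - 1) * B.f (x Idx.r) / x Idx.r ^ 2 =
      (-((N + 2 : ℕ) * (((N + 2 : ℕ) : ℝ) + 1)) / B.ℓ ^ 2
      - (((N + 2 : ℕ) : ℝ) - 2) * (((N + 2 : ℕ) : ℝ) - 3) * B.q ^ 2
        / x Idx.r ^ (2 * (N + 2) - 2) : ℝ) := by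
    simp only [f, f1, f2, h4, h5, Nat.add_sub_cancel]
    push_cast
    field_simp
    ring
  rw [← this]
  push_cast
  ring

lemma IsOuterHorizon.extrinsicTrace_eq (hdim : n = 1 + k + p) (hℓ : 0 < B.ℓ)
    {R : ℝ} (hR : rp < R) (y : BIdx k p → ℝ) :
    extrinsicTrace B.euclMetric Idx.r (atRadius R y) =
      (((√(B.f R))⁻¹ * (-(n - 1) * B.f R / R - B.f1 R / 2) : ℝ) : ℂ) := by
  rw [(h.isMetric hℓ).extrinsicTrace_eq (x := atRadius R y) hR, warped_d hℓ hdim]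
  simp [atRadius]

lemma IsOuterHorizon.ghDensity_eq (hdim : n = 1 + k + p) (hℓ : 0 < B.ℓ)
    {R : ℝ} (hR : rp < R) (y : BIdx k p → ℝ) :
    B.ghDensity R y = ((R ^ (n - 1) * (-(n - 1) * B.f R / R - B.f1 R / 2) : ℝ) : ℂ) := by
  have hf := h.outside R hR
  have hs := (Real.sqrt_pos.2 hf).ne'
  rw [ghDensity, h.extrinsicTrace_eq hdim hℓ hR,
    volDensity_cutoffMetric hℓ hdim (h.pos.trans hR) hf, ← Complex.ofReal_mul]
  congr 1
  field_simp

/-- All curvature terms, the free invariant `H` among them, vanish on the constant cutoff metric;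
the volume term alone remains. -/
lemma IsOuterHorizon.ctDensity_eq (hdim : n = 1 + k + p) (hℓ : 0 < B.ℓ) (H : LocalExpr 0)
    {R : ℝ} (hR : rp < R) (y : BIdx k p → ℝ) :
    B.ctDensity H R y = ((R ^ (n - 1) * √(B.f R) * ((n - 1) / B.ℓ) : ℝ) : ℂ) := by
  have hv := volDensity_cutoffMetric hℓ hdim (h.pos.trans hR) (h.outside R hR) y
  rw [ctDensity]
  simp only [hv]
  rw [cutoffMetric_eq hℓ]
  simp [LocalExpr.eval_const_zero]

omit h

variable (B) in
/-- The factor `√((n-1)/(2n-4)) q` of the gauge potential. -/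
noncomputable def charge : ℝ := √((n - 1) / (2 * n - 4)) * B.q

lemma charge_sq (hn : 3 ≤ n) : B.charge ^ 2 * (2 * n - 4) = (n - 1) * B.q ^ 2 := by
  have hn' : (3 : ℝ) ≤ n := by exact_mod_cast hn
  have h1 : (0 : ℝ) < 2 * n - 4 := by linarith
  rw [charge, mul_pow, Real.sq_sqrt (div_nonneg (by linarith) h1.le), mul_right_comm,
    div_mul_cancel₀ _ h1.ne']

variable (c : Idx k p → ℝ)

lemma euclPotential_eq (x : Idx k p → ℝ) (μ : Idx k p) :
    B.euclPotential c x μ =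
      wickFactor μ * ((-(B.charge / x Idx.r ^ (n - 2)) * B.omega μ + c μ : ℝ) : ℂ) := by
  simp only [euclPotential, wickPotential, potential, charge]
  congr 3
  ring

lemma pd_euclPotential_inr (x : Idx k p → ℝ) (i : BIdx k p) (μ : Idx k p) :
    pd (Sum.inr i) (fun y => B.euclPotential c y μ) x = 0 :=
  pd_transverse (O := Set.univ) (U := fun r =>
    wickFactor μ * ((-(B.charge / r ^ (n - 2)) * B.omega μ + c μ : ℝ) : ℂ))
    (fun y _ => B.euclPotential_eq c y μ) (Set.mem_univ _) i

lemma pd_euclPotential_inl {x : Idx k p → ℝ} (hx : x Idx.r ≠ 0) (i : BIdx k p) :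
    pd (Sum.inl ()) (fun y => B.euclPotential c y (Sum.inr i)) x =
      (((n - 2 : ℕ) * B.charge / x Idx.r ^ (n - 2 + 1) : ℝ) : ℂ) * B.euclOmega i := by
  rw [pd_radial isOpen_univ (U := fun r => wickFactor (Sum.inr i) *
    ((-(B.charge / r ^ (n - 2)) * B.omega (Sum.inr i) + c (Sum.inr i) : ℝ) : ℂ))
    (fun y _ => B.euclPotential_eq c y (Sum.inr i)) (Set.mem_univ _)]
  have h1 := (((hasDerivAt_const_div_pow B.charge (n - 2) hx).neg.mul_const
    (B.omega (Sum.inr i))).add_const (c (Sum.inr i))).ofReal_comp.const_mul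
      (wickFactor (Sum.inr i))
  refine h1.deriv.trans ?_
  simp [euclOmega]
  ring

/-- The components of A depend on r only, so F has a radial leg and no tangential part. -/
lemma inducedField_eucl (R : ℝ) : inducedField (fieldStrength (B.euclPotential c)) R = 0 := by
  ext y i
  simp [inducedField, fieldStrength, pd_euclPotential_inr]

open Matrix in
-- `S'` annihilates ω, so only the `V` part of the inverse metric, with its factor 1/f, acts.
lemma fibreInv_mulVec_euclOmega (hℓ : 0 < B.ℓ) {r : ℝ} (hf : B.f r ≠ 0) :
    (warped hℓ).fibreInv B.f r *ᵥ B.euclOmega =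
      (1 / ((B.f r : ℂ) * (B.ℓ : ℂ) ^ 2)) • (B.euclDiag⁻¹ * B.euclOmega) := by
  have hℓ' : (B.ℓ : ℂ) ≠ 0 := by simp [hℓ.ne']
  have hf' : (B.f r : ℂ) ≠ 0 := by simp [hf]
  have h1 : diagonal B.euclDiag⁻¹ *ᵥ B.euclOmega = B.euclDiag⁻¹ * B.euclOmega := by
    ext; simp [mulVec_diagonal]
  simp only [warped, WarpedData.ofForm, WarpedData.fibreInv, sub_mulVec, smul_mulVec, add_mulVec,
    vecMulVec_mulVec, euclOmega_norm hℓ, h1]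
  ext i
  simp
  field_simp
  ring

lemma fieldStrength_eucl {x : Idx k p → ℝ} (hx : x Idx.r ≠ 0) :
    fieldStrength (B.euclPotential c) x ![Sum.inl (), Sum.inl ()] = 0 ∧
    (∀ i j, fieldStrength (B.euclPotential c) x ![Sum.inr i, Sum.inr j] = 0) ∧
    (∀ i, fieldStrength (B.euclPotential c) x ![Sum.inl (), Sum.inr i] =
      ((((n - 2 : ℕ) * B.charge / x Idx.r ^ (n - 2 + 1) : ℝ) : ℂ) • B.euclOmega) i) ∧
    (∀ i, fieldStrength (B.euclPotential c) x ![Sum.inr i, Sum.inl ()] =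
      -((((n - 2 : ℕ) * B.charge / x Idx.r ^ (n - 2 + 1) : ℝ) : ℂ) • B.euclOmega) i) := by
  refine ⟨?_, ?_, ?_, ?_⟩ <;>
    simp [fieldStrength, pd_euclPotential_inr, pd_euclPotential_inl c hx]

include h

/-- The factor f of g^{rr} cancels the 1/f of the norm of ω, and `charge_sq` converts the
normalisation of the potential into q². -/
lemma IsOuterHorizon.normSq2_field (hn : 3 ≤ n) (hℓ : 0 < B.ℓ)
    {x : Idx k p → ℝ} (hx : rp < x Idx.r) :
    normSq2 B.euclMetric (fieldStrength (B.euclPotential c)) x =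
      ((-((n - 1) * (n - 2) * B.q ^ 2 / x Idx.r ^ (2 * n - 2)) : ℝ) : ℂ) := by
  have hr : x Idx.r ≠ 0 := (h.pos.trans hx).ne'
  have hf := (h.outside _ hx).ne'
  have hℓ' : (B.ℓ : ℂ) ≠ 0 := by simp [hℓ.ne']
  have hf' : (B.f (x Idx.r) : ℂ) ≠ 0 := by simp [hf]
  obtain ⟨h1, h2, h3, h4⟩ := fieldStrength_eucl (B := B) c hr
  rw [normSq2_radial ((h.isMetric hℓ).inv_eq hx) h1 h2 h3 h4, Matrix.mulVec_smul,
    fibreInv_mulVec_euclOmega hℓ hf, smul_dotProduct, dotProduct_smul, dotProduct_smul,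
    dotProduct_comm, euclOmega_norm hℓ]
  have hc := B.charge_sq hn
  have key : -2 * ((n - 2 : ℕ) * B.charge / x Idx.r ^ (n - 2 + 1)) ^ 2 =
      -((n - 1) * (n - 2) * B.q ^ 2 / x Idx.r ^ (2 * n - 2)) := by
    have e1 : x Idx.r ^ (2 * n - 2) = (x Idx.r ^ (n - 2 + 1)) ^ 2 := by
      rw [← pow_mul]; congr 1; omega
    rw [e1, Nat.cast_sub (by omega)]
    field_simp
    push_cast
    linear_combination -((n : ℝ) - 2) * hc
  rw [← key]
  simp only [smul_eq_mul]
  push_cast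
  field_simp

lemma IsOuterHorizon.bulkDensity_eq (hn : 3 ≤ n) (hdim : n = 1 + k + p) (hℓ : 0 < B.ℓ)
    {x : Idx k p → ℝ} (hx : rp < x Idx.r) :
    B.bulkDensity c x = ((-(2 * n / B.ℓ ^ 2) * x Idx.r ^ (n - 1)
      + 2 * (n - 2) * B.q ^ 2 / x Idx.r ^ (n - 1) : ℝ) : ℂ) := by
  have hr : x Idx.r ≠ 0 := (h.pos.trans hx).ne'
  rw [bulkDensity, volDensity_euclMetric hℓ hdim (h.pos.trans hx) (h.outside _ hx),
    h.normSq2_field c hn hℓ hx, h.scalarCurv_eq hn hdim hℓ hx, Lambda]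
  have e1 : x Idx.r ^ (2 * n - 2) = (x Idx.r ^ (n - 1)) ^ 2 := by
    rw [← pow_mul]; congr 1; omega
  have := hℓ.ne'
  have key : x Idx.r ^ (n - 1) * (-(n * (n + 1)) / B.ℓ ^ 2
      - (n - 2) * (n - 3) * B.q ^ 2 / x Idx.r ^ (2 * n - 2) - 2 * (-(n * (n - 1)) / (2 * B.ℓ ^ 2))
      - -((n - 1) * (n - 2) * B.q ^ 2 / x Idx.r ^ (2 * n - 2))) =
      -(2 * n / B.ℓ ^ 2) * x Idx.r ^ (n - 1) + 2 * (n - 2) * B.q ^ 2 / x Idx.r ^ (n - 1) := by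
    rw [e1]
    field_simp
    ring
  rw [← key]
  push_cast
  rfl

omit h in
-- Raising ω with η gives −ℓ²Ξ χ, so pairing a covector with the raised ω evaluates it on the
-- horizon generator; the Wick factors only restore the sign of the time component.
lemma sum_euclDiag_inv_mul (hℓ : 0 < B.ℓ) (u : Idx k p → ℝ) :
    ∑ i, (B.euclDiag⁻¹ * B.euclOmega) i * (wickFactor (Sum.inr i) * (u (Sum.inr i) : ℂ)) =
      ((-(B.ℓ ^ 2 * B.Xi * ∑ μ, u μ * B.chi μ) : ℝ) : ℂ) := by
  have hℓ' := hℓ.ne'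
  have hX := B.Xi_pos.ne'
  have hchi : B.ℓ ^ 2 * B.Xi * ∑ μ, u μ * B.chi μ =
      B.ℓ ^ 2 * B.Xi * u Idx.t + ∑ i, B.a i * u (Idx.phi i) := by
    simp only [Fintype.sum_sum_type, chi, dx, Pi.add_apply, Finset.sum_apply, Pi.smul_apply]
    simp [Pi.single_apply, mul_add, Finset.mul_sum]
    exact Finset.sum_congr rfl fun i _ => by field_simp
  rw [hchi]
  simp only [Fintype.sum_sum_type, Pi.mul_apply, Pi.inv_apply, euclDiag, euclOmega,
    omega_t, omega_phi, omega_flat, wickFactor, Finset.univ_unique, Finset.sum_singleton,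
    Sum.elim_inl, Sum.elim_inr, PUnit.default_eq_unit]
  simp
  linear_combination (B.ℓ : ℂ) ^ 2 * B.Xi * u Idx.t * Complex.I_sq

omit h in
lemma Xi_mul_sum_omega_mul_chi (hℓ : 0 < B.ℓ) : B.Xi * ∑ μ, B.omega μ * B.chi μ = 1 := by
  have hℓ' := hℓ.ne'
  have hX := B.Xi_pos.ne'
  have h1 : ∑ i, B.a i * (B.a i / (B.Xi * B.ℓ ^ 2)) = (B.Xi ^ 2 - 1) / B.Xi := by
    have : ∀ i, B.a i * (B.a i / (B.Xi * B.ℓ ^ 2)) = B.a i ^ 2 / (B.Xi * B.ℓ ^ 2) :=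
      fun i => by ring
    simp only [this, ← Finset.sum_div, sum_a_sq hℓ]
    field_simp
  simp only [Fintype.sum_sum_type, chi, dx, Pi.add_apply, Finset.sum_apply, Pi.smul_apply,
    omega_r, omega_t, omega_phi, omega_flat]
  simp [Pi.single_apply, h1]
  field_simp
  ring

/-- Gauss's law: √γ times the electric field is independent of R, so the only R-dependence is that
of the potential A(χ). -/
lemma IsOuterHorizon.chargeDensity_eq (hn : 3 ≤ n) (hdim : n = 1 + k + p) (hℓ : 0 < B.ℓ)
    {R : ℝ} (hR : rp < R) (y : BIdx k p → ℝ) :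
    B.chargeDensity c R y = (((n - 2) * B.charge *
      (B.charge / R ^ (n - 2) - B.Xi * ∑ μ, c μ * B.chi μ) : ℝ) : ℂ) := by
  have hR0 : R ≠ 0 := (h.pos.trans hR).ne'
  have hf := (h.outside _ hR).ne'
  have hℓ' : (B.ℓ : ℂ) ≠ 0 := by simp [hℓ.ne']
  have hf' : (B.f R : ℂ) ≠ 0 := by simp [hf]
  have hs : ((√(B.f R) : ℝ) : ℂ) ≠ 0 := by simpa using (Real.sqrt_pos.2 (h.outside _ hR)).ne'
  have hx : rp < atRadius R y Idx.r := hR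
  obtain ⟨h1, -, h3, -⟩ := fieldStrength_eucl (B := B) c (x := atRadius R y) hR0
  obtain ⟨r1, r2⟩ := raise2_radial ((h.isMetric hℓ).inv_eq hx) h1 h3
  have hsum : ∑ i, (B.euclDiag⁻¹ * B.euclOmega) i * B.euclPotential c (atRadius R y) (Sum.inr i) =
      ((B.ℓ ^ 2 * (B.charge / R ^ (n - 2) - B.Xi * ∑ μ, c μ * B.chi μ) : ℝ) : ℂ) := by
    simp only [euclPotential_eq]
    rw [sum_euclDiag_inv_mul hℓ
      (fun μ => -(B.charge / atRadius R y Idx.r ^ (n - 2)) * B.omega μ + c μ)]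
    congr 1
    simp only [add_mul, Finset.sum_add_distrib, mul_assoc, ← Finset.mul_sum]
    have := Xi_mul_sum_omega_mul_chi (B := B) hℓ
    simp only [atRadius, Sum.elim_inl]
    linear_combination B.ℓ ^ 2 * (B.charge / R ^ (n - 2)) * this
  rw [chargeDensity, volDensity_cutoffMetric hℓ hdim (h.pos.trans hR) (h.outside R hR)]
  have hsplit : ∀ F : Idx k p → ℂ, ∑ a, F a = F (Sum.inl ()) + ∑ i, F (Sum.inr i) := fun F => by
    rw [Fintype.sum_sum_type]; simp
  simp only [(h.isMetric hℓ).unitConormal_eq hx, hsplit, r1, r2, Matrix.mulVec_smul,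
    fibreInv_mulVec_euclOmega hℓ (r := atRadius R y (Sum.inl ())) hf]
  simp only [reduceCtorEq, if_true, if_false, zero_mul, mul_zero, Finset.sum_const_zero, add_zero,
    zero_add, Pi.smul_apply, smul_eq_mul]
  have : ∀ i, ((√(B.f (atRadius R y (Sum.inl ()))))⁻¹ : ℝ) *
      ((B.f (atRadius R y (Sum.inl ())) : ℂ) * ((((n - 2 : ℕ) * B.charge /
        atRadius R y Idx.r ^ (n - 2 + 1) : ℝ) : ℂ) *
        (1 / ((B.f (atRadius R y (Sum.inl ())) : ℂ) * (B.ℓ : ℂ) ^ 2) *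
          (B.euclDiag⁻¹ * B.euclOmega) i))) * B.euclPotential c (atRadius R y) (Sum.inr i) =
      ((√(B.f R))⁻¹ : ℝ) * ((n - 2 : ℕ) * B.charge / R ^ (n - 2 + 1) : ℝ) / (B.ℓ : ℂ) ^ 2 *
        ((B.euclDiag⁻¹ * B.euclOmega) i * B.euclPotential c (atRadius R y) (Sum.inr i)) := by
    intro i
    simp only [atRadius, Sum.elim_inl]
    field_simp
  simp only [this, ← Finset.mul_sum, hsum]
  have e1 : n - 2 + 1 = n - 1 := by omega
  have hRc : (R : ℂ) ≠ 0 := by simp [hR0]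
  rw [e1, Nat.cast_sub (by omega)]
  push_cast
  field_simp

omit h in
-- Regularity fixes just the component c(χ), and no other part of c enters the charge term.
lemma Xi_mul_sum_of_isRegularGauge (hℓ : 0 < B.ℓ) (hc : B.IsRegularGauge rp c) :
    B.Xi * ∑ μ, c μ * B.chi μ = B.charge / rp ^ (n - 2) := by
  have h1 := hc (fun _ => rp) rfl
  have h2 : ∀ μ, B.potential c (fun _ => rp) μ = -(B.charge / rp ^ (n - 2)) * B.omega μ + c μ := by
    intro μ
    simp only [potential, charge]
    ring
  simp only [h2, add_mul, Finset.sum_add_distrib, mul_assoc, ← Finset.mul_sum] at h1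
  have := Xi_mul_sum_omega_mul_chi (B := B) hℓ
  linear_combination B.Xi * h1 + (B.charge / rp ^ (n - 2)) * this

end Brane

/-! ### Splitting off one coordinate -/

section Measure

variable {ι : Type*}

/-- Separation of the first coordinate. -/
def splitFirst (ι : Type*) : (Unit ⊕ ι → ℝ) ≃ᵐ ℝ × (ι → ℝ) :=
  (MeasurableEquiv.sumPiEquivProdPi fun _ : Unit ⊕ ι => ℝ).trans
    ((MeasurableEquiv.funUnique Unit ℝ).prodCongr (MeasurableEquiv.refl _))

lemma splitFirst_apply (x : Unit ⊕ ι → ℝ) :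
    splitFirst ι x = (x (Sum.inl ()), fun i => x (Sum.inr i)) := rfl

variable [Fintype ι]

lemma measurePreserving_splitFirst : MeasurePreserving (splitFirst ι) volume volume :=
  ((volume_preserving_funUnique Unit ℝ).prod (MeasurePreserving.id volume)).comp
    (volume_measurePreserving_sumPiEquivProdPi fun _ : Unit ⊕ ι => ℝ)

lemma setIntegral_first {S : Set ℝ} {T : Set (ι → ℝ)} (G : ℝ → ℂ) :
    ∫ x in {x : Unit ⊕ ι → ℝ | x (Sum.inl ()) ∈ S ∧ (fun i => x (Sum.inr i)) ∈ T},
      G (x (Sum.inl ())) = (∫ r in S, G r) * (volume T).toReal := by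
  have h := (measurePreserving_splitFirst (ι := ι)).setIntegral_preimage_emb
    (splitFirst ι).measurableEmbedding (fun z => G z.1 * 1) (S ×ˢ T)
  rw [show (volume : Measure (ℝ × (ι → ℝ))) = volume.prod volume from rfl,
    setIntegral_prod_mul G (fun _ => (1 : ℂ))] at h
  simpa [splitFirst_apply, Set.preimage, Set.mem_prod, Measure.real] using h

lemma integrableOn_first {S : Set ℝ} {T : Set (ι → ℝ)} {G : ℝ → ℂ} (hG : IntegrableOn G S)
    (hT : volume T ≠ ⊤) :
    IntegrableOn (fun x => G (x (Sum.inl ())))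
      {x : Unit ⊕ ι → ℝ | x (Sum.inl ()) ∈ S ∧ (fun i => x (Sum.inr i)) ∈ T} := by
  have h1 : IntegrableOn (fun z : ℝ × (ι → ℝ) => G z.1 * 1) (S ×ˢ T) volume := by
    rw [IntegrableOn, show (volume : Measure (ℝ × (ι → ℝ))) = volume.prod volume from rfl,
      ← Measure.prod_restrict]
    have : IsFiniteMeasure (volume.restrict T) := ⟨by simpa using hT.lt_top⟩
    exact Integrable.mul_prod hG (integrable_const 1)
  have h2 := ((measurePreserving_splitFirst (ι := ι)).integrableOn_comp_preimage
    (splitFirst ι).measurableEmbedding).2 h1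
  simpa [splitFirst_apply, Set.preimage, Set.mem_prod, Function.comp_def] using h2

lemma volume_first {S : Set ℝ} {T : Set (ι → ℝ)} :
    volume {x : Unit ⊕ ι → ℝ | x (Sum.inl ()) ∈ S ∧ (fun i => x (Sum.inr i)) ∈ T} =
      volume S * volume T := by
  have h := (measurePreserving_splitFirst (ι := ι)).measure_preimage_emb
    (splitFirst ι).measurableEmbedding (S ×ˢ T)
  rw [show (volume : Measure (ℝ × (ι → ℝ))) = volume.prod volume from rfl,
    Measure.prod_prod] at h
  simpa [splitFirst_apply, Set.preimage, Set.mem_prod] using h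

end Measure

/-! ### Volumes of the regions, integrability and the bulk integral -/

namespace Brane

variable {n k p : ℕ} {B : Brane n k p} {Y : Set (Fin p → ℝ)} {rp : ℝ}

lemma volume_bdryRegion :
    volume (B.bdryRegion Y rp) =
      ENNReal.ofReal (B.beta rp) * (ENNReal.ofReal (2 * Real.pi) ^ k * volume Y) := by
  have h1 := volume_first (ι := Fin k ⊕ Fin p) (S := Set.Icc 0 (B.beta rp))
    (T := {z | (∀ i, z (Sum.inl i) ∈ Set.Icc 0 (2 * Real.pi)) ∧ (fun j => z (Sum.inr j)) ∈ Y})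
  have h2 := (volume_measurePreserving_sumPiEquivProdPi
    fun _ : Fin k ⊕ Fin p => ℝ).measure_preimage_emb
    (MeasurableEquiv.sumPiEquivProdPi _).measurableEmbedding
    ((Set.univ.pi fun _ => Set.Icc 0 (2 * Real.pi)) ×ˢ Y)
  rw [Measure.volume_eq_prod, Measure.prod_prod, volume_pi_pi] at h2
  have h3 : (MeasurableEquiv.sumPiEquivProdPi fun _ : Fin k ⊕ Fin p => ℝ) ⁻¹'
      ((Set.univ.pi fun _ => Set.Icc 0 (2 * Real.pi)) ×ˢ Y) =
      {z | (∀ i, z (Sum.inl i) ∈ Set.Icc 0 (2 * Real.pi)) ∧ (fun j => z (Sum.inr j)) ∈ Y} := by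
    ext z
    simp only [Set.mem_preimage, Set.mem_prod, Set.mem_univ_pi, Set.mem_ofPred_eq]
    rfl
  rw [h3] at h2
  rw [h2] at h1
  refine Eq.trans h1 ?_
  simp

lemma IsOuterHorizon.beta_pos (h : B.IsOuterHorizon rp) : 0 < B.beta rp :=
  div_pos (mul_pos (by positivity) B.Xi_pos) h.nonextreme

lemma IsOuterHorizon.volume_bdryRegion_toReal (h : B.IsOuterHorizon rp) :
    (volume (B.bdryRegion Y rp)).toReal = B.beta rp * (volume Y).toReal * (2 * Real.pi) ^ k := by
  rw [volume_bdryRegion, ENNReal.toReal_mul, ENNReal.toReal_mul, ENNReal.toReal_pow,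
    ENNReal.toReal_ofReal h.beta_pos.le, ENNReal.toReal_ofReal (by positivity)]
  ring

lemma volume_bdryRegion_ne_top (hY : volume Y ≠ ⊤) : volume (B.bdryRegion Y rp) ≠ ⊤ := by
  rw [volume_bdryRegion]
  exact ENNReal.mul_ne_top ENNReal.ofReal_ne_top
    (ENNReal.mul_ne_top (ENNReal.pow_ne_top ENNReal.ofReal_ne_top) hY)

lemma IsOuterHorizon.setIntegral_bdryRegion_const (h : B.IsOuterHorizon rp) (a : ℝ)
    {u : (BIdx k p → ℝ) → ℂ} (hu : ∀ y, u y = a) :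
    ∫ y in B.bdryRegion Y rp, u y =
      ((B.beta rp * (volume Y).toReal * (2 * Real.pi) ^ k * a : ℝ) : ℂ) := by
  simp only [hu, setIntegral_const, Measure.real, h.volume_bdryRegion_toReal]
  simp

lemma integrableOn_bdryRegion_const (hY : volume Y ≠ ⊤) (a : ℂ)
    {u : (BIdx k p → ℝ) → ℂ} (hu : ∀ y, u y = a) : IntegrableOn u (B.bdryRegion Y rp) := by
  rw [show u = fun _ => a from funext hu]
  exact integrableOn_const (volume_bdryRegion_ne_top hY)

lemma measurableSet_bdryRegion (hY : MeasurableSet Y) : MeasurableSet (B.bdryRegion Y rp) := by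
  have : B.bdryRegion Y rp = (fun y : BIdx k p → ℝ => y (Sum.inl ())) ⁻¹' Set.Icc 0 (B.beta rp) ∩
      ((⋂ i, (fun y : BIdx k p → ℝ => y (Sum.inr (Sum.inl i))) ⁻¹' Set.Icc 0 (2 * Real.pi)) ∩
        (fun (y : BIdx k p → ℝ) j => y (Sum.inr (Sum.inr j))) ⁻¹' Y) := by
    ext y
    simp only [Set.mem_inter_iff, Set.mem_iInter, Set.mem_preimage]
    rfl
  rw [this]
  refine (measurable_pi_apply _ measurableSet_Icc).inter
    ((MeasurableSet.iInter fun i => measurable_pi_apply _ measurableSet_Icc).inter ?_)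
  exact (measurable_pi_lambda _ fun j => measurable_pi_apply _) hY

lemma measurableSet_bulkRegion (hY : MeasurableSet Y) (R : ℝ) :
    MeasurableSet (B.bulkRegion Y rp R) := by
  have : B.bulkRegion Y rp R = (fun x : Idx k p → ℝ => x Idx.r) ⁻¹' Set.Icc rp R ∩
      (fun (x : Idx k p → ℝ) b => x (Sum.inr b)) ⁻¹' B.bdryRegion Y rp := rfl
  rw [this]
  exact (measurable_pi_apply _ measurableSet_Icc).inter
    ((measurable_pi_lambda _ fun b => measurable_pi_apply _) (measurableSet_bdryRegion hY))

/-- The metric degenerates where f = 0, so the closed form is available only for r > r₊; the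
hyperplane r = r₊ is null. -/
lemma IsOuterHorizon.bulkDensity_ae (h : B.IsOuterHorizon rp) (c : Idx k p → ℝ) (hn : 3 ≤ n)
    (hdim : n = 1 + k + p) (hℓ : 0 < B.ℓ) (R : ℝ) :
    ∀ᵐ x : Idx k p → ℝ, x ∈ B.bulkRegion Y rp R →
      B.bulkDensity c x = ((-(2 * n / B.ℓ ^ 2) * x Idx.r ^ (n - 1)
        + 2 * (n - 2) * B.q ^ 2 / x Idx.r ^ (n - 1) : ℝ) : ℂ) := by
  have h0 : ∀ᵐ x : Idx k p → ℝ, x Idx.r ≠ rp := by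
    rw [ae_iff]
    simpa [volume_pi] using
      Measure.pi_hyperplane (fun _ : Idx k p => (volume : Measure ℝ)) Idx.r rp
  filter_upwards [h0] with x hx hmem
  exact h.bulkDensity_eq c hn hdim hℓ (lt_of_le_of_ne hmem.1.1 (Ne.symm hx))

lemma IsOuterHorizon.continuousOn_radialDensity (h : B.IsOuterHorizon rp) (R : ℝ) :
    ContinuousOn (fun r : ℝ => -(2 * n / B.ℓ ^ 2) * r ^ (n - 1)
        + 2 * (n - 2) * B.q ^ 2 / r ^ (n - 1)) (Set.Icc rp R) := by
  refine ContinuousOn.add (by fun_prop) (ContinuousOn.div (by fun_prop) (by fun_prop) ?_)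
  exact fun r hr => pow_ne_zero _ (h.pos.trans_le hr.1).ne'

lemma IsOuterHorizon.integrableOn_bulkDensity (h : B.IsOuterHorizon rp) (c : Idx k p → ℝ)
    (hn : 3 ≤ n) (hdim : n = 1 + k + p) (hℓ : 0 < B.ℓ) (hY : MeasurableSet Y)
    (hYfin : volume Y ≠ ⊤) (R : ℝ) : IntegrableOn (B.bulkDensity c) (B.bulkRegion Y rp R) := by
  have h1 : IntegrableOn (fun r : ℝ => ((-(2 * n / B.ℓ ^ 2) * r ^ (n - 1)
        + 2 * (n - 2) * B.q ^ 2 / r ^ (n - 1) : ℝ) : ℂ)) (Set.Icc rp R) :=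
    (Complex.continuous_ofReal.comp_continuousOn
      (h.continuousOn_radialDensity R)).integrableOn_Icc
  have h2 := integrableOn_first h1 (volume_bdryRegion_ne_top (B := B) (rp := rp) hYfin)
  refine IntegrableOn.congr_fun_ae h2 ?_
  rw [EventuallyEq, ae_restrict_iff' (measurableSet_bulkRegion hY R)]
  filter_upwards [h.bulkDensity_ae (Y := Y) c hn hdim hℓ R] with x hx hmem
  exact (hx hmem).symm

lemma IsOuterHorizon.integral_bulkDensity (h : B.IsOuterHorizon rp) (c : Idx k p → ℝ)
    (hn : 3 ≤ n) (hdim : n = 1 + k + p) (hℓ : 0 < B.ℓ) (hY : MeasurableSet Y)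
    {R : ℝ} (hR : rp < R) : ∫ x in B.bulkRegion Y rp R, B.bulkDensity c x =
      ((B.beta rp * (volume Y).toReal * (2 * Real.pi) ^ k *
        (-2 / B.ℓ ^ 2 * (R ^ n - rp ^ n)
          - 2 * B.q ^ 2 * (1 / R ^ (n - 2) - 1 / rp ^ (n - 2))) : ℝ) : ℂ) := by
  rw [setIntegral_congr_ae (measurableSet_bulkRegion hY R)
    (h.bulkDensity_ae (Y := Y) c hn hdim hℓ R)]
  refine (setIntegral_first (ι := BIdx k p) (S := Set.Icc rp R) (T := B.bdryRegion Y rp)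
    (fun r : ℝ => ((-(2 * n / B.ℓ ^ 2) * r ^ (n - 1)
        + 2 * (n - 2) * B.q ^ 2 / r ^ (n - 1) : ℝ) : ℂ))).trans ?_
  rw [h.volume_bdryRegion_toReal, integral_complex_ofReal, ← Complex.ofReal_mul]
  congr 1
  rw [mul_comm]
  congr 1
  rw [integral_Icc_eq_integral_Ioc, ← intervalIntegral.integral_of_le hR.le]
  rw [intervalIntegral.integral_eq_sub_of_hasDerivAt
    (f := fun r => -2 / B.ℓ ^ 2 * r ^ n - 2 * B.q ^ 2 / r ^ (n - 2))]
  · ring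
  · intro r hr
    rw [Set.uIcc_of_le hR.le] at hr
    have hr0 : r ≠ 0 := (h.pos.trans_le hr.1).ne'
    have := ((hasDerivAt_pow n r).const_mul (-2 / B.ℓ ^ 2)).sub
      (hasDerivAt_const_div_pow (2 * B.q ^ 2) (n - 2) hr0)
    refine this.congr_deriv ?_
    rw [show n - 2 + 1 = n - 1 by omega, Nat.cast_sub (by omega)]
    push_cast
    ring
  · refine ContinuousOn.intervalIntegrable ?_
    rw [Set.uIcc_of_le hR.le]
    exact h.continuousOn_radialDensity R

end Brane

/-! ### The cutoff R → ∞ -/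

namespace Brane

variable {n k p : ℕ} {B : Brane n k p} {Y : Set (Fin p → ℝ)} {rp : ℝ}

lemma tendsto_const_div_pow_atTop (b : ℝ) {j : ℕ} (hj : j ≠ 0) :
    Tendsto (fun r : ℝ => b / r ^ j) atTop (𝓝 0) :=
  tendsto_const_nhds.div_atTop (tendsto_pow_atTop hj)

lemma tendsto_excess (hn : 3 ≤ n) : Tendsto B.excess atTop (𝓝 0) := by
  unfold excess
  simpa using (tendsto_const_div_pow_atTop B.m (j := n - 2) (by omega)).sub
    (tendsto_const_div_pow_atTop (B.q ^ 2) (j := 2 * n - 4) (by omega))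

lemma tendsto_sqrt_f_div (hn : 3 ≤ n) (hℓ : 0 < B.ℓ) :
    Tendsto (fun r => √(B.f r) / r) atTop (𝓝 (1 / B.ℓ)) := by
  have h1 : Tendsto (fun r => 1 / B.ℓ ^ 2 - B.excess r / r ^ 2) atTop (𝓝 (1 / B.ℓ ^ 2)) := by
    simpa using tendsto_const_nhds.sub ((tendsto_excess hn).div_atTop
      (tendsto_pow_atTop (α := ℝ) (two_ne_zero)))
  have h2 := h1.sqrt
  rw [show √(1 / B.ℓ ^ 2) = 1 / B.ℓ by
    rw [Real.sqrt_div zero_le_one, Real.sqrt_one, Real.sqrt_sq hℓ.le]] at h2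
  refine h2.congr' ?_
  filter_upwards [eventually_gt_atTop 0] with r hr
  have : 1 / B.ℓ ^ 2 - B.excess r / r ^ 2 = B.f r / r ^ 2 := by
    rw [f_eq]
    field_simp
  rw [this, Real.sqrt_div' _ (by positivity), Real.sqrt_sq hr.le]

/-- Difference of squares: multiplying by ℓ√f/R + 1, which tends to 2, turns the expression into
R^(n-2) f − Rⁿ/ℓ² = −m + q²/R^(n-2). -/
lemma IsOuterHorizon.tendsto_pow_mul_sqrt_f (h : B.IsOuterHorizon rp) (hn : 3 ≤ n)
    (hℓ : 0 < B.ℓ) : Tendsto (fun R => R ^ (n - 1) * √(B.f R) / B.ℓ - R ^ n / B.ℓ ^ 2) atTop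
      (𝓝 (-B.m / 2)) := by
  have hℓ' := hℓ.ne'
  have h1 := (tendsto_const_div_pow_atTop (B.q ^ 2) (j := n - 2) (by omega)).const_add (-B.m)
  have h2 := ((tendsto_sqrt_f_div hn hℓ).const_mul B.ℓ).add_const 1
  have h3 := h1.div h2 (by rw [mul_one_div_cancel hℓ']; norm_num)
  rw [mul_one_div_cancel hℓ', add_zero, one_add_one_eq_two] at h3
  refine h3.congr' ?_
  filter_upwards [eventually_gt_atTop rp] with R hR
  have hR0 := h.pos.trans hR
  have hf := h.outside R hR
  have hs := Real.sqrt_pos.2 hf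
  have hsq := Real.sq_sqrt hf.le
  have hpos : (0 : ℝ) < B.ℓ * √(B.f R) + R := by positivity
  rw [Pi.div_apply, div_eq_iff (by positivity)]
  have hfe : R ^ (n - 2) * B.f R = R ^ n / B.ℓ ^ 2 - B.m + B.q ^ 2 / R ^ (n - 2) := by
    have e1 : R ^ n = R ^ (n - 2) * R ^ 2 := by rw [← pow_add]; congr 1; omega
    have e2 : R ^ (2 * n - 4) = R ^ (n - 2) * R ^ (n - 2) := by rw [← pow_add]; congr 1; omega
    rw [f, e1, e2]
    field_simp
  have e1 : R ^ n = R ^ (n - 2) * R ^ 2 := by rw [← pow_add]; congr 1; omega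
  have e2 : R ^ (n - 1) = R ^ (n - 2) * R := by rw [← pow_succ]; congr 1; omega
  have : (R ^ (n - 1) * √(B.f R) / B.ℓ - R ^ n / B.ℓ ^ 2) * (B.ℓ * (√(B.f R) / R) + 1) =
      R ^ (n - 2) * √(B.f R) ^ 2 - R ^ n / B.ℓ ^ 2 := by
    rw [e1, e2]
    field_simp
    ring
  rw [this, hsq, hfe]
  ring

lemma IsOuterHorizon.m_eq (h : B.IsOuterHorizon rp) (hn : 3 ≤ n) :
    B.m = rp ^ n / B.ℓ ^ 2 + B.q ^ 2 / rp ^ (n - 2) := by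
  have h0 := h.root
  have hr := h.pos.ne'
  have e1 : rp ^ n = rp ^ (n - 2) * rp ^ 2 := by rw [← pow_add]; congr 1; omega
  have e2 : rp ^ (2 * n - 4) = rp ^ (n - 2) * rp ^ (n - 2) := by rw [← pow_add]; congr 1; omega
  rw [f, e2] at h0
  have h1 : rp ^ (n - 2) * (rp ^ 2 / B.ℓ ^ 2 - B.m / rp ^ (n - 2)
      + B.q ^ 2 / (rp ^ (n - 2) * rp ^ (n - 2))) =
      rp ^ n / B.ℓ ^ 2 - B.m + B.q ^ 2 / rp ^ (n - 2) := by
    rw [e1]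
    field_simp
  rw [h0, mul_zero] at h1
  linarith

/-- The Gibbons–Hawking density `√γ Θ` in terms of the parameters of `f`. -/
lemma gibbonsHawking_identity (hn : 3 ≤ n) {R : ℝ} (hR : R ≠ 0) :
    R ^ (n - 1) * (-(n - 1) * B.f R / R - B.f1 R / 2) =
      n * B.m / 2 - n * (R ^ n / B.ℓ ^ 2) - B.q ^ 2 / R ^ (n - 2) := by
  obtain ⟨N, rfl⟩ : ∃ N, n = N + 2 := ⟨n - 2, by omega⟩
  have h4 : 2 * (N + 2) - 4 = 2 * N := by omega
  have h5 : N + 2 - 1 = N + 1 := by omega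
  simp only [f, f1, h4, h5, Nat.add_sub_cancel]
  push_cast
  field_simp
  ring

/-- The q²/R^(n-2) terms of the bulk and Gibbons–Hawking integrals cancel exactly, and their Rⁿ
terms leave −(n−1)Rⁿ/ℓ², to be balanced by the volume counterterm. -/
lemma IsOuterHorizon.actionGC_eq (h : B.IsOuterHorizon rp) (c : Idx k p → ℝ) (H : LocalExpr 0)
    (hn : 3 ≤ n) (hdim : n = 1 + k + p) (hℓ : 0 < B.ℓ) (hY : MeasurableSet Y)
    {R : ℝ} (hR : rp < R) : B.actionGC Y rp c H R =
      ((B.beta rp * (volume Y).toReal * (2 * Real.pi) ^ k / (8 * Real.pi) *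
        (n * B.m / 2 - rp ^ n / B.ℓ ^ 2 - B.q ^ 2 / rp ^ (n - 2) +
          (n - 1) * (R ^ (n - 1) * √(B.f R) / B.ℓ - R ^ n / B.ℓ ^ 2)) : ℝ) : ℂ) := by
  rw [actionGC, actionG, actionCt, h.integral_bulkDensity c hn hdim hℓ hY hR,
    h.setIntegral_bdryRegion_const _ (h.ghDensity_eq hdim hℓ hR),
    h.setIntegral_bdryRegion_const _ (h.ctDensity_eq hdim hℓ H hR),
    gibbonsHawking_identity hn (h.pos.trans hR).ne']
  have hpi := Real.pi_ne_zero
  generalize B.beta rp * (volume Y).toReal * (2 * Real.pi) ^ k = C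
  have key : -(1 / (16 * Real.pi)) * (C * (-2 / B.ℓ ^ 2 * (R ^ n - rp ^ n)
          - 2 * B.q ^ 2 * (1 / R ^ (n - 2) - 1 / rp ^ (n - 2))))
      + 1 / (8 * Real.pi) * (C * (n * B.m / 2 - n * (R ^ n / B.ℓ ^ 2) - B.q ^ 2 / R ^ (n - 2)))
      + 1 / (8 * Real.pi) * (C * (R ^ (n - 1) * √(B.f R) * ((n - 1) / B.ℓ))) =
      C / (8 * Real.pi) *
        (n * B.m / 2 - rp ^ n / B.ℓ ^ 2 - B.q ^ 2 / rp ^ (n - 2) +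
          (n - 1) * (R ^ (n - 1) * √(B.f R) / B.ℓ - R ^ n / B.ℓ ^ 2)) := by
    have e : 1 / (16 * Real.pi) = 1 / (8 * Real.pi) / 2 := by field_simp; norm_num
    rw [e]
    ring
  rw [← key]
  push_cast
  ring

lemma pow_div_identity (hn : 3 ≤ n) (hℓ : 0 < B.ℓ) {r b : ℝ} (hr : r ≠ 0) :
    (r ^ (2 * n - 2) + b * B.q ^ 2 * B.ℓ ^ 2) / (r ^ (n - 2) * B.ℓ ^ 2) =
      r ^ n / B.ℓ ^ 2 + b * (B.q ^ 2 / r ^ (n - 2)) := by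
  have := hℓ.ne'
  rw [show r ^ (2 * n - 2) = r ^ (n - 2) * r ^ n by rw [← pow_add]; congr 1; omega]
  field_simp

lemma IsOuterHorizon.tendsto_actionGC (h : B.IsOuterHorizon rp) (c : Idx k p → ℝ)
    (H : LocalExpr 0) (hn : 3 ≤ n) (hdim : n = 1 + k + p) (hℓ : 0 < B.ℓ)
    (hY : MeasurableSet Y) : Tendsto (B.actionGC Y rp c H) atTop
      (𝓝 ((-(B.beta rp * (volume Y).toReal * (2 * Real.pi) ^ k / (16 * Real.pi)) *
          ((rp ^ (2 * n - 2) + B.q ^ 2 * B.ℓ ^ 2) / (rp ^ (n - 2) * B.ℓ ^ 2)) : ℝ) : ℂ)) := by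
  have h1 := (((h.tendsto_pow_mul_sqrt_f hn hℓ).const_mul ((n : ℝ) - 1)).const_add
    (n * B.m / 2 - rp ^ n / B.ℓ ^ 2 - B.q ^ 2 / rp ^ (n - 2))).const_mul
    (B.beta rp * (volume Y).toReal * (2 * Real.pi) ^ k / (8 * Real.pi))
  have h2 := (Complex.continuous_ofReal.tendsto _).comp h1
  -- The mass enters as nm/2 − (n−1)m/2 = m/2, and the horizon equation makes this half of the r₊
  -- terms it is added to, with opposite sign.
  have e : B.beta rp * (volume Y).toReal * (2 * Real.pi) ^ k / (8 * Real.pi) *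
      (n * B.m / 2 - rp ^ n / B.ℓ ^ 2 - B.q ^ 2 / rp ^ (n - 2) + (n - 1) * (-B.m / 2)) =
      -(B.beta rp * (volume Y).toReal * (2 * Real.pi) ^ k / (16 * Real.pi)) *
          ((rp ^ (2 * n - 2) + B.q ^ 2 * B.ℓ ^ 2) / (rp ^ (n - 2) * B.ℓ ^ 2)) := by
    have := pow_div_identity (B := B) (b := 1) hn hℓ h.pos.ne'
    rw [one_mul, one_mul] at this
    rw [this, h.m_eq hn]
    have := Real.pi_ne_zero
    field_simp
    ring
  rw [← e]
  refine h2.congr' ?_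
  filter_upwards [eventually_gt_atTop rp] with R hR
  exact (h.actionGC_eq c H hn hdim hℓ hY hR).symm

lemma IsOuterHorizon.tendsto_actionC (h : B.IsOuterHorizon rp) (c : Idx k p → ℝ)
    (H : LocalExpr 0) (hn : 3 ≤ n) (hdim : n = 1 + k + p) (hℓ : 0 < B.ℓ)
    (hY : MeasurableSet Y) (hc : B.IsRegularGauge rp c) : Tendsto (B.actionC Y rp c H) atTop
      (𝓝 ((-(B.beta rp * (volume Y).toReal * (2 * Real.pi) ^ k / (16 * Real.pi)) *
          ((rp ^ (2 * n - 2) - (2 * n - 3) * B.q ^ 2 * B.ℓ ^ 2) /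
            (rp ^ (n - 2) * B.ℓ ^ 2)) : ℝ) : ℂ)) := by
  have hpi := Real.pi_ne_zero
  have h1 : Tendsto (fun R : ℝ => 1 / (4 * Real.pi) *
      (B.beta rp * (volume Y).toReal * (2 * Real.pi) ^ k *
        ((n - 2) * B.charge * (B.charge / R ^ (n - 2) - B.charge / rp ^ (n - 2))))) atTop
      (𝓝 (1 / (4 * Real.pi) * (B.beta rp * (volume Y).toReal * (2 * Real.pi) ^ k *
        ((n - 2) * B.charge * (0 - B.charge / rp ^ (n - 2)))))) :=
    ((((tendsto_const_div_pow_atTop B.charge (j := n - 2) (by omega)).sub_const _).const_mul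
      _).const_mul _).const_mul _
  have h2 := (h.tendsto_actionGC c H hn hdim hℓ hY).sub
    ((Complex.continuous_ofReal.tendsto _).comp h1)
  rw [← Complex.ofReal_sub] at h2
  -- By `charge_sq` the boundary term shifts the coefficient of q² from 1 to 1 − 2(n−1) = −(2n−3).
  have e : -(B.beta rp * (volume Y).toReal * (2 * Real.pi) ^ k / (16 * Real.pi)) *
          ((rp ^ (2 * n - 2) + B.q ^ 2 * B.ℓ ^ 2) / (rp ^ (n - 2) * B.ℓ ^ 2)) -
      1 / (4 * Real.pi) * (B.beta rp * (volume Y).toReal * (2 * Real.pi) ^ k *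
        ((n - 2) * B.charge * (0 - B.charge / rp ^ (n - 2)))) =
      -(B.beta rp * (volume Y).toReal * (2 * Real.pi) ^ k / (16 * Real.pi)) *
          ((rp ^ (2 * n - 2) - (2 * n - 3) * B.q ^ 2 * B.ℓ ^ 2) /
            (rp ^ (n - 2) * B.ℓ ^ 2)) := by
    have i1 := pow_div_identity (B := B) (b := 1) hn hℓ h.pos.ne'
    have i2 := pow_div_identity (B := B) (b := -(2 * n - 3)) hn hℓ h.pos.ne'
    rw [one_mul, one_mul] at i1
    rw [neg_mul, neg_mul, ← sub_eq_add_neg] at i2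
    rw [i1, i2]
    have hq := charge_sq (B := B) hn
    have hr := pow_ne_zero (n - 2) h.pos.ne'
    generalize B.beta rp * (volume Y).toReal * (2 * Real.pi) ^ k = C
    field_simp
    linear_combination (8 * B.ℓ ^ 2 * C) * hq
  rw [← e]
  refine h2.congr' ?_
  filter_upwards [eventually_gt_atTop rp] with R hR
  rw [actionC, h.setIntegral_bdryRegion_const _ (h.chargeDensity_eq c hn hdim hℓ hR),
    Xi_mul_sum_of_isRegularGauge c hℓ hc]
  simp

lemma emCounterterm_eq_zero (c : Idx k p → ℝ) (R : ℝ) : B.emCounterterm Y rp c R = 0 := by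
  simp [emCounterterm, inducedField_eucl]

/-- √γ F² is a constant times (√f/R)/R^(n-2); √f/R stays bounded, so it decays. -/
lemma IsOuterHorizon.tendsto_emCountertermBulk (h : B.IsOuterHorizon rp) (c : Idx k p → ℝ)
    (hn : 3 ≤ n) (hdim : n = 1 + k + p) (hℓ : 0 < B.ℓ) :
    Tendsto (B.emCountertermBulk Y rp c) atTop (𝓝 0) := by
  have h1 := (((tendsto_sqrt_f_div (B := B) hn hℓ).mul (tendsto_const_div_pow_atTop
    (-((n - 8) / (n - 4) * ((n - 1) * (n - 2) * B.q ^ 2))) (j := n - 2) (by omega))).const_mul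
    (B.beta rp * (volume Y).toReal * (2 * Real.pi) ^ k)).const_mul (B.ℓ / (256 * Real.pi))
  simp only [mul_zero] at h1
  have h2 := (Complex.continuous_ofReal.tendsto _).comp h1
  rw [Complex.ofReal_zero] at h2
  refine h2.congr' ?_
  filter_upwards [eventually_gt_atTop rp] with R hR
  have hR0 : R ≠ 0 := (h.pos.trans hR).ne'
  have hu : ∀ y : BIdx k p → ℝ, (volDensity (B.cutoffMetric R) y : ℂ) *
      (((n - 8) / (n - 4) : ℝ) : ℂ) *
      normSq2 B.euclMetric (fieldStrength (B.euclPotential c)) (atRadius R y) =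
      ((√(B.f R) / R * (-((n - 8) / (n - 4) * ((n - 1) * (n - 2) * B.q ^ 2)) / R ^ (n - 2)) : ℝ)
        : ℂ) := by
    intro y
    rw [volDensity_cutoffMetric hℓ hdim (h.pos.trans hR) (h.outside R hR),
      h.normSq2_field c hn hℓ (x := atRadius R y) hR, ← Complex.ofReal_mul, ← Complex.ofReal_mul]
    congr 1
    have e1 : R ^ (2 * n - 2) = R ^ (n - 1) * (R ^ (n - 2) * R) := by
      rw [← pow_succ, ← pow_add]; congr 1; omega
    simp only [atRadius, Sum.elim_inl, e1]
    field_simp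
  rw [emCountertermBulk, h.setIntegral_bdryRegion_const _ hu, ← Complex.ofReal_mul]
  rfl

end Brane

/-! ### The asymptotic radial coordinate and the leading boundary data -/

/-- A function with positive derivative on a half-line, tending to infinity, has a differentiable
inverse near infinity, which tends to infinity. -/
lemma exists_inverse_atTop {U U' : ℝ → ℝ} {a : ℝ} (hU : ∀ r > a, HasDerivAt U (U' r) r)
    (hpos : ∀ r > a, 0 < U' r) (htop : Tendsto U atTop atTop) :
    ∃ (b : ℝ) (σ : ℝ → ℝ), (∀ u > b, a < σ u ∧ U (σ u) = u ∧ HasDerivAt σ (U' (σ u))⁻¹ u) ∧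
      Tendsto σ atTop atTop := by
  -- Nothing is assumed about U at a itself, so the inverse is built from a + 1 on.
  set b := U (a + 1) with hb
  have hmono : StrictMonoOn U (Set.Ioi a) := by
    refine strictMonoOn_of_deriv_pos (convex_Ioi a)
      (fun r hr => (hU r hr).continuousAt.continuousWithinAt) fun r hr => ?_
    rw [interior_Ioi] at hr
    rw [(hU r hr).deriv]
    exact hpos r hr
  have hex : ∀ u, ∃ s, u > b → a + 1 < s ∧ U s = u := by
    intro u
    by_cases hu : u > b
    · obtain ⟨R, hR1, hR2⟩ := ((htop.eventually_gt_atTop u).and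
        (eventually_gt_atTop (a + 1))).exists
      obtain ⟨s, hs, hs'⟩ := intermediate_value_Ioo hR2.le (f := U) (fun r hr =>
        (hU r (by linarith [hr.1])).continuousAt.continuousWithinAt) ⟨hu, hR1⟩
      exact ⟨s, fun _ => ⟨hs.1, hs'⟩⟩
    · exact ⟨0, fun h => absurd h hu⟩
  choose σ hσ using hex
  have hlt : ∀ u > b, a < σ u := fun u hu => by linarith [(hσ u hu).1]
  have hinv : ∀ s > a + 1, σ (U s) = s := by
    intro s hs
    have hs' : U s > b := hmono (by simp) (show a < s by linarith) hs
    exact hmono.injOn (hlt _ hs') (show a < s by linarith) (hσ _ hs').2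
  have hσmono : StrictMonoOn σ (Set.Ioi b) := by
    intro u hu v hv huv
    rw [← (hmono.lt_iff_lt (hlt u hu) (hlt v hv)), (hσ u hu).2, (hσ v hv).2]
    exact huv
  refine ⟨b, σ, fun u hu => ⟨hlt u hu, (hσ u hu).2, ?_⟩, ?_⟩
  -- A monotone function whose image contains a neighbourhood of its value is continuous there;
  -- `hinv` supplies the preimages.
  · have hcont : ContinuousAt σ u := by
      refine continuousAt_of_monotoneOn_of_image_mem_nhds hσmono.monotoneOn (Ioi_mem_nhds hu) ?_
      refine mem_of_superset (Ioi_mem_nhds (hσ u hu).1) fun s hs => ?_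
      exact ⟨U s, hmono (by simp) (show a < s by linarith [Set.mem_Ioi.1 hs]) hs, hinv s hs⟩
    refine HasDerivAt.of_local_left_inverse hcont (hU _ (hlt u hu)) (hpos _ (hlt u hu)).ne' ?_
    filter_upwards [Ioi_mem_nhds hu] with v hv using (hσ v hv).2
  · refine tendsto_atTop.2 fun s => ?_
    have hm : a < max s (a + 1) := lt_max_of_lt_right (by linarith)
    filter_upwards [eventually_gt_atTop b, eventually_gt_atTop (U (max s (a + 1)))] with u hu hu'
    rw [← (hσ u hu).2] at hu'
    exact (le_max_left _ _).trans ((hmono.lt_iff_lt hm (hlt u hu)).1 hu').le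

namespace Brane

variable {n k p : ℕ} {B : Brane n k p} {Y : Set (Fin p → ℝ)} {rp : ℝ}

lemma f_continuousOn : ContinuousOn B.f (Set.Ioi 0) := fun _ hr =>
  (hasDerivAt_f (ne_of_gt hr)).continuousAt.continuousWithinAt

/-- Since r² − ℓ²f = ℓ² `excess`, rationalising r − ℓ√f shows that the difference is `excess` times
a quantity of order r⁻³; this yields integrability at infinity. -/
lemma IsOuterHorizon.tendsto_tortoise (h : B.IsOuterHorizon rp) (hn : 3 ≤ n) (hℓ : 0 < B.ℓ) :
    Tendsto (fun r => (1 / (B.ℓ * √(B.f r)) - 1 / r) / r ^ (-2 : ℝ)) atTop (𝓝 0) := by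
  have h1 := tendsto_sqrt_f_div (B := B) hn hℓ
  have h2 := h1.mul ((h1.const_mul B.ℓ).const_add 1)
  have h3 := (tendsto_excess (B := B) hn).const_mul B.ℓ
  have h4 := h3.div h2 (by rw [mul_one_div_cancel hℓ.ne']; have := hℓ.ne'; positivity)
  have h5 := h4.mul tendsto_inv_atTop_zero
  simp only [mul_zero] at h5
  refine h5.congr' ?_
  filter_upwards [eventually_gt_atTop rp] with r hr
  have hr0 := h.pos.trans hr
  have hf := h.outside r hr
  have hs := Real.sqrt_pos.2 hf
  have hsq := Real.sq_sqrt hf.le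
  have hex : B.excess r = (r ^ 2 - B.ℓ ^ 2 * √(B.f r) ^ 2) / B.ℓ ^ 2 := by
    rw [hsq, f_eq]
    field_simp
    ring
  have hpos : 0 < r + B.ℓ * √(B.f r) := by positivity
  rw [Real.rpow_neg hr0.le, Real.rpow_two, Pi.div_apply, hex]
  field_simp
  ring

lemma IsOuterHorizon.exists_tortoise (h : B.IsOuterHorizon rp) (hn : 3 ≤ n) (hℓ : 0 < B.ℓ) :
    ∃ U : ℝ → ℝ, (∀ r > rp + 1, HasDerivAt U (1 / (B.ℓ * √(B.f r))) r) ∧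
      Tendsto (fun r => Real.log r - U r) atTop (𝓝 0) := by
  set G : ℝ → ℝ := fun r => 1 / (B.ℓ * √(B.f r)) - 1 / r with hG
  have hcont : ContinuousOn G (Set.Ioi rp) := by
    refine ContinuousOn.sub (ContinuousOn.div continuousOn_const (continuousOn_const.mul
      (Real.continuous_sqrt.comp_continuousOn (f_continuousOn.mono
        (Set.Ioi_subset_Ioi h.pos.le)))) ?_)
      (ContinuousOn.div continuousOn_const continuousOn_id ?_)
    · exact fun r hr => (mul_pos hℓ (Real.sqrt_pos.2 (h.outside r hr))).ne'
    · exact fun r hr => (h.pos.trans hr).ne'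
  have hsub : Set.Ici (rp + 1) ⊆ Set.Ioi rp := fun r hr => by
    simp only [Set.mem_Ici, Set.mem_Ioi] at *; linarith
  have hint : IntegrableOn G (Set.Ici (rp + 1)) := by
    refine LocallyIntegrableOn.integrableOn_of_isBigO_atTop
      ((hcont.mono hsub).locallyIntegrableOn measurableSet_Ici)
      (g := fun r => r ^ (-2 : ℝ)) ?_ (integrableAtFilter_rpow_atTop_iff.2 (by norm_num))
    refine (Asymptotics.isLittleO_of_tendsto' ?_ (h.tendsto_tortoise hn hℓ)).isBigO
    filter_upwards [eventually_gt_atTop 0] with r hr h0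
    exact absurd h0 (Real.rpow_pos_of_pos hr _).ne'
  have hlim := intervalIntegral_tendsto_integral_Ioi (rp + 1)
    (hint.mono_set Set.Ioi_subset_Ici_self) tendsto_id
  set I := ∫ r in Set.Ioi (rp + 1), G r
  -- Subtracting the full integral `I` selects the primitive with U − log r → 0, hence the
  -- normalisation x r → 1. The base point r₊ + 1 avoids the singularity of 1/√f at the horizon.
  refine ⟨fun r => Real.log r + ((∫ s in (rp + 1)..r, G s) - I), fun r hr => ?_, ?_⟩
  · have hr' : rp < r := by linarith
    have h1 : HasDerivAt (fun r => ∫ s in (rp + 1)..r, G s) (G r) r := by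
      refine intervalIntegral.integral_hasDerivAt_right ?_ ?_ (hcont.continuousAt (Ioi_mem_nhds hr'))
      · exact (hcont.mono fun s hs => by
          rw [Set.uIcc_of_le (le_of_lt hr)] at hs; exact hsub hs.1).intervalIntegrable
      · exact hcont.stronglyMeasurableAtFilter isOpen_Ioi r hr'
    refine ((Real.hasDerivAt_log (h.pos.trans hr').ne').add (h1.sub_const I)).congr_deriv ?_
    simp [hG]
  · have := (hlim.sub_const I).neg
    simpa using this

lemma IsOuterHorizon.exists_isAsymptoticCoordinate (h : B.IsOuterHorizon rp) (hn : 3 ≤ n)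
    (hℓ : 0 < B.ℓ) : ∃ x₀ ρ, B.IsAsymptoticCoordinate rp x₀ ρ := by
  obtain ⟨U, hU, hlim⟩ := h.exists_tortoise hn hℓ
  have htop : Tendsto U atTop atTop := by
    have := Real.tendsto_log_atTop.atTop_add hlim.neg
    refine this.congr fun r => by ring
  obtain ⟨b, σ, hσ, hσtop⟩ := exists_inverse_atTop hU (fun r hr => by
    have := Real.sqrt_pos.2 (h.outside r (by linarith)); positivity) htop
  have hb : ∀ x ∈ Set.Ioo 0 (Real.exp (-b)), -Real.log x > b := fun x hx => by
    have := (Real.log_lt_iff_lt_exp hx.1).2 hx.2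
    linarith
  have hder : ∀ x ∈ Set.Ioo 0 (Real.exp (-b)), HasDerivAt (fun x => σ (-Real.log x))
      ((1 / (B.ℓ * √(B.f (σ (-Real.log x)))))⁻¹ * -x⁻¹) x := fun x hx =>
    HasDerivAt.comp x (hσ _ (hb x hx)).2.2 (Real.hasDerivAt_log hx.1.ne').neg
  refine ⟨Real.exp (-b), fun x => σ (-Real.log x), ⟨Real.exp_pos _, fun x hx => ?_,
    fun x hx => (hder x hx).differentiableAt, fun x hx => ?_, ?_⟩⟩
  · linarith [(hσ _ (hb x hx)).1]
  · have hf := h.outside (σ (-Real.log x)) (by linarith [(hσ _ (hb x hx)).1])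
    have hx0 := hx.1.ne'
    rw [(hder x hx).deriv, one_div, inv_inv, mul_pow, mul_pow, Real.sq_sqrt hf.le]
    field_simp
  · have hlog : Tendsto (fun x : ℝ => -Real.log x) (𝓝[>] 0) atTop :=
      tendsto_neg_atBot_atTop.comp Real.tendsto_log_nhdsGT_zero
    -- With x = exp(−U(r)), the product x r equals exp(log r − U(r)).
    have h1 := (Real.continuous_exp.tendsto 0).comp ((hlim.comp hσtop).comp hlog)
    rw [Real.exp_zero] at h1
    refine h1.congr' ?_
    filter_upwards [Ioo_mem_nhdsGT (Real.exp_pos (-b))] with x hx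
    have hs := hσ _ (hb x hx)
    simp only [Function.comp_apply, hs.2.1, sub_neg_eq_add]
    rw [Real.exp_add, Real.exp_log hx.1, Real.exp_log (by linarith [h.pos, hs.1]), mul_comm]

lemma IsAsymptoticCoordinate.tendsto_atTop {x₀ : ℝ} {ρ : ℝ → ℝ}
    (hρ : B.IsAsymptoticCoordinate rp x₀ ρ) : Tendsto ρ (𝓝[>] 0) atTop := by
  refine (hρ.normalized.pos_mul_atTop one_pos tendsto_inv_nhdsGT_zero).congr' ?_
  filter_upwards [self_mem_nhdsWithin] with x hx
  have : x ≠ 0 := ne_of_gt hx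
  field_simp

lemma inducedField_potential (c : Idx k p → ℝ) (R : ℝ) :
    inducedField (fieldStrength (B.potential c)) R = 0 := by
  have h1 : ∀ (x : Idx k p → ℝ) (i : BIdx k p) (μ : Idx k p),
      pd (Sum.inr i) (fun y => B.potential c y μ) x = 0 := fun x i μ =>
    pd_transverse (O := Set.univ) (U := fun r => -√((n - 1) / (2 * n - 4)) * (B.q / r ^ (n - 2))
      * B.omega μ + c μ) (fun y _ => rfl) (Set.mem_univ _) i
  ext y i
  simp [inducedField, fieldStrength, h1]

/-- By the normal form, x²γ = (x r)² η + x² `excess` ω⊗ω, and the last term tends to zero. -/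
lemma IsAsymptoticCoordinate.isLeadingData {x₀ : ℝ} {ρ : ℝ → ℝ}
    (hρ : B.IsAsymptoticCoordinate rp x₀ ρ) (hn : 3 ≤ n) (hℓ : 0 < B.ℓ) (c : Idx k p → ℝ) :
    B.IsLeadingData ρ c B.flatBoundaryMetric 0 := by
  refine ⟨fun y i j => ?_, fun y i => ?_⟩
  · have h1 := (hρ.normalized.pow 2).mul_const (B.flatBoundaryMetric y i j)
    have h2 : Tendsto (fun x : ℝ => x ^ 2) (𝓝[>] 0) (𝓝 0) :=
      ((continuous_pow 2).tendsto' (0 : ℝ) 0 (by simp)).mono_left nhdsWithin_le_nhds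
    have h3 := (h2.mul ((tendsto_excess (B := B) hn).comp hρ.tendsto_atTop)).mul_const
      (B.omega (Sum.inr i) * B.omega (Sum.inr j))
    have h4 := h1.add h3
    simp only [one_pow, one_mul, mul_zero, zero_mul, add_zero] at h4
    refine h4.congr fun x => ?_
    simp only [inducedMetric, metric_eq B hℓ, Matrix.submatrix_apply, Matrix.fromBlocks_apply₂₂,
      Matrix.add_apply, Matrix.smul_apply, Matrix.vecMulVec_apply, smul_eq_mul, atRadius,
      Sum.elim_inl, Function.comp_apply, show B.flatBoundaryMetric 0 = B.flatBoundaryMetric y from rfl]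
    ring
  · simp only [inducedField_potential]
    exact tendsto_const_nhds

lemma IsLeadingData.unique {ρ : ℝ → ℝ} {c : Idx k p → ℝ} {γ γ' : MetricField (BIdx k p) ℝ}
    {F F' : TensorField (BIdx k p) ℝ 2} (h : B.IsLeadingData ρ c γ F)
    (h' : B.IsLeadingData ρ c γ' F') : γ = γ' ∧ F = F' :=
  ⟨by ext y i j; exact tendsto_nhds_unique (h.1 y i j) (h'.1 y i j),
    by ext y i; exact tendsto_nhds_unique (h.2 y i) (h'.2 y i)⟩

end Brane

end BlackBrane

theorem mainTheorem2 (n k p : ℕ) (hn : 3 ≤ n) (hdim : n = 1 + k + p)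
    (B : BlackBrane.Brane n k p) (hℓ : 0 < B.ℓ)
    (Y : Set (Fin p → ℝ)) (hY : MeasurableSet Y) (hYfin : volume Y ≠ ⊤)
    (rp : ℝ) (hrp : B.IsOuterHorizon rp) (c : BlackBrane.Idx k p → ℝ) :
    -- all integrals converge at every finite cutoff
    (∀ (H : BlackBrane.LocalExpr 0) (R : ℝ), rp < R →
      IntegrableOn (B.bulkDensity c) (B.bulkRegion Y rp R) ∧
      IntegrableOn (B.ghDensity R) (B.bdryRegion Y rp) ∧
      IntegrableOn (B.ctDensity H R) (B.bdryRegion Y rp) ∧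
      IntegrableOn (B.chargeDensity c R) (B.bdryRegion Y rp)) ∧
    -- the grand-canonical action
    (∀ H : BlackBrane.LocalExpr 0,
      Tendsto (B.actionGC Y rp c H) atTop
        (𝓝 ((-(B.beta rp * (volume Y).toReal * (2 * Real.pi) ^ k / (16 * Real.pi)) *
          ((rp ^ (2 * n - 2) + B.q ^ 2 * B.ℓ ^ 2) / (rp ^ (n - 2) * B.ℓ ^ 2)) : ℝ) : ℂ))) ∧
    -- the canonical action, in a gauge that is regular at the horizon
    (∀ H : BlackBrane.LocalExpr 0, B.IsRegularGauge rp c →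
      Tendsto (B.actionC Y rp c H) atTop
        (𝓝 ((-(B.beta rp * (volume Y).toReal * (2 * Real.pi) ^ k / (16 * Real.pi)) *
          ((rp ^ (2 * n - 2) - (2 * n - 3) * B.q ^ 2 * B.ℓ ^ 2) /
            (rp ^ (n - 2) * B.ℓ ^ 2)) : ℝ) : ℂ))) ∧
    -- the leading boundary metric is flat and the leading boundary field vanishes
    (∃ x₀ ρ, B.IsAsymptoticCoordinate rp x₀ ρ) ∧
    (∀ x₀ ρ, B.IsAsymptoticCoordinate rp x₀ ρ → B.IsLeadingData ρ c B.flatBoundaryMetric 0) ∧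
    BlackBrane.riemannDown B.flatBoundaryMetric = 0 ∧
    BlackBrane.ricci B.flatBoundaryMetric = 0 ∧
    BlackBrane.scalarCurv B.flatBoundaryMetric = 0 ∧
    -- all logarithmic divergences vanish
    (∀ x₀ ρ γ₀ F₀, B.IsAsymptoticCoordinate rp x₀ ρ → B.IsLeadingData ρ c γ₀ F₀ → ∀ ε > 0,
      (n = 4 → B.logWeyl4 (B.bdryRegion Y rp) γ₀ ε = 0 ∧
        B.logEM4 (B.bdryRegion Y rp) γ₀ F₀ ε = 0) ∧
      (n = 6 → B.logWeyl6 (B.bdryRegion Y rp) γ₀ ε = 0 ∧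
        B.logEM6 (B.bdryRegion Y rp) γ₀ F₀ ε = 0) ∧
      (∀ L : BlackBrane.LocalExpr 0,
        BlackBrane.Brane.logLocal (B.bdryRegion Y rp) γ₀ F₀ L ε = 0)) ∧
    -- the electromagnetic counterterm vanishes
    (4 < n → (∀ R, rp < R → B.emCounterterm Y rp c R = 0) ∧
      Tendsto (B.emCountertermBulk Y rp c) atTop (𝓝 0)) := by
  refine ⟨fun H R hR => ⟨?_, ?_, ?_, ?_⟩, fun H => hrp.tendsto_actionGC c H hn hdim hℓ hY,
    fun H hc => hrp.tendsto_actionC c H hn hdim hℓ hY hc,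
    hrp.exists_isAsymptoticCoordinate hn hℓ, fun x₀ ρ hρ => hρ.isLeadingData hn hℓ c,
    BlackBrane.riemannDown_const _, BlackBrane.ricci_const _, BlackBrane.scalarCurv_const _, ?_,
    fun _ => ⟨fun R _ => BlackBrane.Brane.emCounterterm_eq_zero c R,
      hrp.tendsto_emCountertermBulk c hn hdim hℓ⟩⟩
  · exact hrp.integrableOn_bulkDensity c hn hdim hℓ hY hYfin R
  · exact BlackBrane.Brane.integrableOn_bdryRegion_const hYfin _ (hrp.ghDensity_eq hdim hℓ hR)
  · exact BlackBrane.Brane.integrableOn_bdryRegion_const hYfin _ (hrp.ctDensity_eq hdim hℓ H hR)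
  · exact BlackBrane.Brane.integrableOn_bdryRegion_const hYfin _
      (hrp.chargeDensity_eq c hn hdim hℓ hR)
  · intro x₀ ρ γ₀ F₀ hρ hlead ε _
    obtain ⟨rfl, rfl⟩ := hlead.unique (hρ.isLeadingData hn hℓ c)
    -- Unfolding exposes a constant function, to which the vanishing lemmas for constant metrics
    -- apply; every integrand is then zero, whatever ln ε is.
    unfold BlackBrane.Brane.flatBoundaryMetric
    refine ⟨fun _ => ⟨?_, ?_⟩, fun _ => ⟨?_, ?_⟩, fun L => ?_⟩
    · simp [BlackBrane.Brane.logWeyl4]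
    · simp [BlackBrane.Brane.logEM4]
    · simp [BlackBrane.Brane.logWeyl6]
    · simp [BlackBrane.Brane.logEM6]
    · simp [BlackBrane.Brane.logLocal, BlackBrane.LocalExpr.eval_const_zero]
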